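/- **Setting.** Let $\mathcal G=(V,E)$ be a finite, connected, undirected block graph, i.e. every maximal biconnected vertex set (one that induces a connected subgraph which remains connected after removal of any single node) is a clique. "Clique" below means maximal clique; $\mathcal C$ is the set of cliques, and $\mathcal S$ is the set of nodes $s$ such that $\{s\}$ is a minimal separator between two distinct cliques. Any two nodes $a,b$ are joined by a unique shortest path; $(a\rightsquigarrow b)$ denotes its set of edges, directed from $a$ to $b$. Let $X=(X_v)_{v\in V}$ be a random vector with values in $[0,\infty)^V$ which is a Markov random field with respect to $\mathcal G$: for all non-empty, pairwise disjoint $A,B,S\subset V$ such that every path from $A$ to $B$ meets $S$, the vectors $X_A$ and $X_B$ are conditionally independent given $X_S$. Conditional laws given $X_s$ are regular conditional distributions. They are determined only up to null sets of the law of $X_s$; accordingly, a limit as $t\to\infty$ of conditional laws given $X_s=t$ is taken along $t$ outside a null set of the law of $X_s$, and a supremum over values of $X_s/t$ is an essential supremum with respect to the law of $X_s/t$. (So neither depends on the version of the conditional laws.) **Assumption 1.** For every $C\in\mathcal C$ and $s\in C$, $\nu_{C,s}$ is a probability distribution on $[0,\infty)^{C\setminus s}$ such that, as $t\to\infty$,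 $\mathcal L(X_v/t,\ v\in C\setminus s\mid X_s=t)$ converges weakly to $\nu_{C,s}$. **Assumption 2.** Let $u\in V$, let $s\in\mathcal S$, and let $C$ be a clique that contains $s$ but no other node of the shortest path from $u$ to $s$. If there is an edge $(a,b)\in(u\rightsquigarrow s)$ such that $\nu_{C',a}(\{y: y_b=0\})>0$, where $C'$ is the clique containing $a$ and $b$, then for every $\eta>0$ $$\limsup_{\delta\downarrow0}\ \limsup_{t\to\infty}\ \sup_{x_s\in[0,\delta]}\mathbb P\bigl(\exists v\in C\setminus s:\ X_v/t>\eta\ \big|\ X_s/t=x_s\bigr)=0 .$$ **Increments.** Fix $u\in V$. For each clique $C$ let $s=s_{u,C}$ be the node of $C$ through which every path from $u$ to every node of $C$ passes ($s=u$ if $u\in C$). Let $Z=(Z_{sv},\ v\in C\setminus s)_{C\in\mathcal C}$ be such that for each $C$ the vector $(Z_{sv})_{v\in C\setminus s}$ has law $\nu_{C,s}$ and these vectors are mutually independent as $C$ ranges over $\mathcal C$ (within one clique the increments may be dependent). Put $$A_{uv}=\prod_{e\in(u\rightsquigarrow v)}Z_e,\qquad v\in V\setminus u .$$ **Theorem.**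 Under Assumptions 1 and 2, for every $u\in V$, as $t\to\infty$, the conditional law of $(X_v/t,\ v\in V\setminus u)$ given $X_u=t$ converges weakly to the law of $(A_{uv},\ v\in V\setminus u)$. -/

import Mathlib

open MeasureTheory ProbabilityTheory Filter Topology
open scoped NNReal ENNReal

noncomputable section

namespace MarkovBlockGraph

universe u

/-! ### Graphs -/

section Graph

variable {V : Type u} (G : SimpleGraph V)

/-- A vertex set is biconnected if the subgraph it induces is connected and stays connected after
the removal of any single vertex (single vertices and single edges are biconnected). -/
def IsBiconnected (B : Set V) : Prop :=
  (G.induce B).Connected ∧ ∀ v ∈ B, (G.induce (B \ {v})).Preconnected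

/-- A block is a maximal biconnected vertex set. -/
def IsBlock (B : Set V) : Prop :=
  Maximal (IsBiconnected G) B

/-- A block graph is a graph all of whose blocks are cliques. -/
def IsBlockGraph : Prop :=
  ∀ B : Set V, IsBlock G B → G.IsClique B

/-- The type of (inclusion-)maximal cliques of `G`. -/
abbrev MaxClique : Type u := {C : Set V // Maximal G.IsClique C}

instance [Finite V] : Fintype (MaxClique G) := Fintype.ofFinite _

/-- `S` separates `A` from `B`: every path from a node of `A` to a node of `B` meets `S`. -/
def IsSeparator (S A B : Set V) : Prop :=
  ∀ a ∈ A, ∀ b ∈ B, ∀ p : G.Walk a b, p.IsPath → ∃ w ∈ p.support, w ∈ S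

/-- `S` is a separator of `A` and `B`, and no proper subset of `S` is one. -/
def IsMinimalSeparator (S A B : Set V) : Prop :=
  Minimal (fun T => IsSeparator G T A B) S

/-- The nodes `s` such that `{s}` is a minimal separator between two distinct maximal cliques. -/
def separatorNodes : Set V :=
  {s | ∃ C D : MaxClique G, C ≠ D ∧ IsMinimalSeparator G {s} C.1 D.1}

/-- `s` is the separator node in `C` between `u` and the nodes of `C`: it belongs to `C`, and every
path from `u` to a node of `C` passes through `s`. (If `u ∈ C`, this forces `s = u`.) -/
def IsSepNode (u : V) (C : Set V) (s : V) : Prop :=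
  s ∈ C ∧ ∀ v ∈ C, ∀ p : G.Walk u v, p.IsPath → s ∈ p.support

open Classical in
/-- The separator node in `C` between `u` and `C`. In a connected block graph there is exactly one
node as in `IsSepNode`; the value `u` in the other case is never used. -/
def sepNode (u : V) (C : Set V) : V :=
  if h : ∃ s, IsSepNode G u C s then h.choose else u

variable {G}

/-- A shortest path from `a` to `b`. In a connected block graph it is the unique one. -/
def shortestPath (hG : G.Connected) (a b : V) : G.Walk a b :=
  (hG.exists_walk_length_eq_dist a b).choose

end Graph

/-! ### Random fields, described by their law on `V → ℝ≥0` -/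

section Field

variable {V : Type u} [Finite V] (G : SimpleGraph V)

/-- The global Markov property of a law `P` on `V → ℝ≥0` with respect to `G`: if `S` separates `A`
and `B`, then the coordinates in `A` and those in `B` are conditionally independent given the
coordinates in `S`. -/
def IsMarkovRandomField (P : Measure (V → ℝ≥0)) [IsFiniteMeasure P] : Prop :=
  ∀ A B S : Set V, A.Nonempty → B.Nonempty → S.Nonempty →
    Disjoint A B → Disjoint A S → Disjoint B S → IsSeparator G S A B →
      CondIndepFun (MeasurableSpace.comap (S.domRestrict (π := fun _ => ℝ≥0)) inferInstance)
        (measurable_pi_lambda _ fun v => measurable_pi_apply v.1).comap_le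
        (A.domRestrict (π := fun _ => ℝ≥0)) (B.domRestrict (π := fun _ => ℝ≥0)) P

/-- The law of the coordinate `s` under `P`. -/
def margin (P : Measure (V → ℝ≥0)) (s : V) : Measure ℝ≥0 :=
  P.map (fun x => x s)

/-- The regular conditional distribution of the coordinates in `A` given the coordinate `s`. -/
def condLaw (P : Measure (V → ℝ≥0)) [IsFiniteMeasure P] (A : Set V) (s : V) :
    Kernel ℝ≥0 (A → ℝ≥0) :=
  condDistrib (A.domRestrict (π := fun _ => ℝ≥0)) (fun x => x s) P

instance (P : Measure (V → ℝ≥0)) [IsFiniteMeasure P] (A : Set V) (s : V) :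
    IsMarkovKernel (condLaw P A s) := by
  unfold condLaw; infer_instance

/-- The conditional law of `(X_v / t, v ∈ A)` given `X_s = t`, where `X` has law `P`. -/
def scaledCondLaw (P : Measure (V → ℝ≥0)) [IsFiniteMeasure P] (A : Set V) (s : V) (t : ℝ≥0) :
    ProbabilityMeasure (A → ℝ≥0) :=
  ProbabilityMeasure.map ⟨condLaw P A s t, inferInstance⟩ (f := fun y v => y v / t)
    (measurable_pi_lambda _ fun v => (measurable_pi_apply v).div_const t).aemeasurable

/-- `L(X_v / t, v ∈ A | X_s = t)` converges weakly to `ν` as `t → ∞`. The conditional law given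
`X_s = t` is determined by the law of `X` only up to a null set of values `t` for the law of `X_s`,
and the limit is taken for `t → ∞` outside such a null set; so it does not depend on the version of
the conditional law. -/
def CondTendsto (P : Measure (V → ℝ≥0)) [IsFiniteMeasure P] (A : Set V) (s : V)
    (ν : ProbabilityMeasure (A → ℝ≥0)) : Prop :=
  Tendsto (scaledCondLaw P A s) (atTop ⊓ ae (margin P s)) (𝓝 ν)

variable {G}

/-- For every maximal clique `C` and every `s ∈ C`, the conditional law of `(X_v / t, v ∈ C \ s)`
given `X_s = t` converges weakly to `ν C s` as `t → ∞`. (The values `ν C s` with `s ∉ C` play no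
role.) -/
def CliquewiseLimits (P : Measure (V → ℝ≥0)) [IsFiniteMeasure P]
    (ν : (C : MaxClique G) → (s : V) → ProbabilityMeasure (↥(C.1 \ {s}) → ℝ≥0)) : Prop :=
  ∀ C : MaxClique G, ∀ s ∈ C.1, CondTendsto P (C.1 \ {s}) s (ν C s)

/-- The limit relation
`limsup_{δ ↓ 0} limsup_{t → ∞} sup_{x ∈ [0, δ]} P(∃ v ∈ A, X_v / t > η | X_s / t = x) = 0`
for every `η > 0`. The supremum is the essential one with respect to the law of `X_s / t`, so that
it does not depend on the version of the conditional law. -/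
def SmallGivenSmall (P : Measure (V → ℝ≥0)) [IsFiniteMeasure P] (A : Set V) (s : V) : Prop :=
  ∀ η : ℝ≥0, 0 < η →
    limsup (fun δ : ℝ≥0 =>
      limsup (fun t : ℝ≥0 =>
        essSup (fun x : ℝ≥0 => condLaw P A s (t * x) {y | ∃ v, η < y v / t})
          (((margin P s).map (fun z => z / t)).restrict (Set.Icc 0 δ))) atTop) (𝓝[>] 0) = 0

/-- The assumption on near-zero values: if `s` is a separator node, `C` is a maximal clique that
contains `s` but no other node of the shortest path from `u` to `s`, and some edge `(a, b)` of that
path, in the maximal clique `C'` say, is such that the `b`-th margin of `ν C' a` has an atom at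
zero, then `SmallGivenSmall` holds for `C \ s` given `s`. -/
def ZeroAssumption (hG : G.Connected) (P : Measure (V → ℝ≥0)) [IsFiniteMeasure P]
    (ν : (C : MaxClique G) → (s : V) → ProbabilityMeasure (↥(C.1 \ {s}) → ℝ≥0)) : Prop :=
  ∀ u : V, ∀ s ∈ separatorNodes G, ∀ C : MaxClique G,
    s ∈ C.1 → (∀ w ∈ (shortestPath hG u s).support, w ∈ C.1 → w = s) →
    (∃ e ∈ (shortestPath hG u s).darts, ∃ C' : MaxClique G,
      e.fst ∈ C'.1 ∧ ∃ hb : e.snd ∈ C'.1 \ {e.fst},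
        0 < ((ν C' e.fst : Measure (↥(C'.1 \ {e.fst}) → ℝ≥0)).map fun y => y ⟨e.snd, hb⟩) {0}) →
    SmallGivenSmall P (C.1 \ {s}) s

/-! ### The limit -/

variable (G) in
/-- The values of the increment vector `Z` started at `u`: one sub-vector
`(Z_{sv}, v ∈ C \ s)` for each maximal clique `C`, with `s` the separator node of `C`. -/
abbrev IncrementSpace (u : V) : Type u :=
  (C : MaxClique G) → (↥(C.1 \ {sepNode G u C.1}) → ℝ≥0)

/-- The law of the increment vector `Z`: the sub-vector of the clique `C` with separator node `s`
has law `ν C s`, and the sub-vectors of different cliques are independent. -/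
def incrementLaw (ν : (C : MaxClique G) → (s : V) → ProbabilityMeasure (↥(C.1 \ {s}) → ℝ≥0))
    (u : V) : ProbabilityMeasure (IncrementSpace G u) :=
  ⟨Measure.pi fun C => (ν C (sepNode G u C.1) : Measure _), inferInstance⟩

open Classical in
/-- The component `Z_{ab}` of the increment vector `z`: the component `b` of the sub-vector of the
clique `C` whose separator node is `a` and for which `b ∈ C \ a`. In a connected block graph there
is exactly one such `C` if `(a, b)` is an edge of the shortest path from `u` to some node; the value
`0` in the other case is never used. -/
def increment (u : V) (a b : V) (z : IncrementSpace G u) : ℝ≥0 :=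
  if h : ∃ C : MaxClique G, sepNode G u C.1 = a ∧ b ∈ C.1 \ {sepNode G u C.1} then
    z h.choose ⟨b, h.choose_spec.2⟩
  else 0

/-- `A_{uv}`, the product of the increments `Z_e` over the edges `e` of the shortest path from `u`
to `v`. -/
def pathProduct (hG : G.Connected) (u v : V) (z : IncrementSpace G u) : ℝ≥0 :=
  ((shortestPath hG u v).darts.map fun e => increment u e.fst e.snd z).prod

theorem measurable_increment (u a b : V) :
    Measurable (increment (G := G) u a b) := by
  unfold increment
  split_ifs with h
  · exact (measurable_pi_apply _).comp (measurable_pi_apply _)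
  · exact measurable_const

theorem measurable_pathProduct (hG : G.Connected) (u v : V) :
    Measurable (pathProduct hG u v) := by
  unfold pathProduct
  induction (shortestPath hG u v).darts with
  | nil => simp
  | cons e l ih =>
    simp only [List.map_cons, List.prod_cons]
    exact (measurable_increment u e.fst e.snd).mul ih

theorem measurable_pathProducts (hG : G.Connected) (u : V) :
    Measurable (fun (z : IncrementSpace G u) (v : ↥({u}ᶜ : Set V)) => pathProduct hG u v.1 z) :=
  measurable_pi_lambda _ fun v => measurable_pathProduct hG u v.1

/-- The law of `(A_{uv}, v ∈ V \ u)`. -/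
def limitLaw (hG : G.Connected)
    (ν : (C : MaxClique G) → (s : V) → ProbabilityMeasure (↥(C.1 \ {s}) → ℝ≥0)) (u : V) :
    ProbabilityMeasure (↥({u}ᶜ : Set V) → ℝ≥0) :=
  (incrementLaw ν u).map (measurable_pathProducts hG u).aemeasurable

end Field

end MarkovBlockGraph

end

/-! Root the graph at `u`. Every node other than `u` lies in `C \ s` for exactly one clique `C` with
separator node `s`, so the field can be built by adding the cliques one at a time, in order of the
distance from `u` to their separator nodes. Let `W` be the nodes covered so far and `B = C \ s` the
next ones. Removing `s` separates the rest of `W` from `B` (`reachableAvoiding_sepNode_false`), so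
by the Markov property the law on `W ∪ B` given `X_u = t` is the law on `W` followed by a transition
that depends on `x_s` only (`fieldKernel_union`).

Suppose the field on `W`, divided by `t`, converges. Where its limit is positive at `s`, the value
`X_s` is itself of order `t`, and Assumption 1 says that `X_B / X_s` is asymptotically `ν C s`. The
limit can vanish at `s` with positive probability only if some increment on the path to `s` has an
atom at zero; then Assumption 2 applies and forces `X_B / t` to be small, in agreement with `0 * Z =
0`. An extended continuous mapping theorem (`tendsto_integral_of_locally_close`) combines the two
cases in `tendsto_scaledField_union`. The limit is the right one because `A_{uv} = A_{us} Z_{sv}`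
and the sub-vector of `C` is independent of the products on `W` (`limitFieldLaw_insert`).

Conditional laws given `X_s` are controlled only off a null set of values of `X_s`;
`ae_scaledField_of_ae_margin` turns this into a statement for almost every value of `X_u`. -/

open scoped BoundedContinuousFunction

namespace MarkovBlockGraph

universe u

/-! ### Cliques, separator nodes and shortest paths in block graphs. -/

section

section Graph

variable {V : Type u} {G : SimpleGraph V}

/-- `a` and `b` are joined by a walk that avoids `s`. -/
def ReachableAvoiding (G : SimpleGraph V) (s a b : V) : Prop :=
  ∃ p : G.Walk a b, s ∉ p.support

namespace ReachableAvoiding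

variable {s a b c : V}

theorem symm (h : ReachableAvoiding G s a b) : ReachableAvoiding G s b a := by
  obtain ⟨p, hp⟩ := h
  exact ⟨p.reverse, by simpa using hp⟩

theorem trans (h : ReachableAvoiding G s a b) (h' : ReachableAvoiding G s b c) :
    ReachableAvoiding G s a c := by
  obtain ⟨p, hp⟩ := h
  obtain ⟨q, hq⟩ := h'
  exact ⟨p.append q, by simp [SimpleGraph.Walk.mem_support_append_iff, hp, hq]⟩

theorem refl (h : s ≠ a) : ReachableAvoiding G s a a := ⟨.nil, by simpa using h⟩

theorem of_adj (h : G.Adj a b) (ha : s ≠ a) (hb : s ≠ b) : ReachableAvoiding G s a b :=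
  ⟨.cons h .nil, by simp [ha, hb]⟩

theorem exists_isPath (h : ReachableAvoiding G s a b) :
    ∃ p : G.Walk a b, p.IsPath ∧ s ∉ p.support := by
  classical
  obtain ⟨p, hp⟩ := h
  exact ⟨p.bypass, p.bypass_isPath, fun h => hp (p.support_bypass_subset_support h)⟩

theorem of_isClique {C : Set V} (hC : G.IsClique C) (ha : a ∈ C) (hb : b ∈ C) (hsa : s ≠ a)
    (hsb : s ≠ b) : ReachableAvoiding G s a b := by
  by_cases h : a = b
  · subst h; exact refl hsa
  · exact of_adj (hC ha hb h) hsa hsb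

end ReachableAvoiding

theorem preconnected_induce_of_forall_walk {B : Set V} (s : V) (hs : s ∈ B)
    (h : ∀ w ∈ B, ∃ p : G.Walk w s, ∀ x ∈ p.support, x ∈ B) : (G.induce B).Preconnected := by
  intro x y
  have key : ∀ z : B, (G.induce B).Reachable z ⟨s, hs⟩ := by
    rintro ⟨z, hz⟩
    obtain ⟨p, hp⟩ := h z hz
    exact ⟨p.induce B hp⟩
  exact (key x).trans (key y).symm

/-- A path together with a further node adjacent to both of its ends is biconnected. -/
theorem isBiconnected_insert_support {s a b : V} (has : G.Adj a s) (hbs : G.Adj b s)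
    {p : G.Walk a b} (hp : p.IsPath) (hsp : s ∉ p.support) :
    IsBiconnected G (insert s {x | x ∈ p.support}) := by
  classical
  constructor
  · have : Nonempty ↥(insert s {x | x ∈ p.support}) := ⟨s, by simp⟩
    refine ⟨preconnected_induce_of_forall_walk s (by simp) fun w hw => ?_⟩
    rcases hw with rfl | hw
    · exact ⟨.nil, by simp⟩
    · refine ⟨(p.dropUntil w hw).concat hbs, fun x hx => ?_⟩
      simp only [SimpleGraph.Walk.support_concat, List.mem_append,
        List.mem_singleton] at hx
      rcases hx with hx | rfl
      · exact Or.inr (p.support_dropUntil_subset_support hw hx)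
      · simp
  · intro v hv
    by_cases hvs : v = s
    · subst hvs
      have : insert v {x | x ∈ p.support} \ {v} = {x | x ∈ p.support} := by
        ext x
        simp only [Set.mem_sdiff, Set.mem_insert_iff, Set.mem_ofPred_eq, Set.mem_singleton_iff]
        constructor
        · rintro ⟨h1 | h1, h2⟩
          · exact absurd h1 h2
          · exact h1
        · intro h
          exact ⟨Or.inr h, fun e => hsp (e ▸ h)⟩
      rw [this]
      exact p.connected_induce_support.preconnected
    · refine preconnected_induce_of_forall_walk s ⟨by simp, fun h => hvs h.symm⟩ fun w hw => ?_
      obtain ⟨hw | hw, hwv⟩ := hw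
      · subst hw
        exact ⟨.nil, by simpa using fun h => hvs h.symm⟩
      -- A path visits `v` only once, so at least one of the two pieces into which `w` cuts it
      -- avoids `v`; that piece leads to an end of the path, and from there to `s`.
      · by_cases hd : v ∈ (p.dropUntil w hw).support
        · have ht : v ∉ (p.takeUntil w hw).support := by
            intro ht
            have hnd : (p.takeUntil w hw |>.append (p.dropUntil w hw)).IsPath := by
              rwa [SimpleGraph.Walk.take_spec]
            have hd' : v ∈ (p.dropUntil w hw).support.tail := by
              rw [← SimpleGraph.Walk.cons_tail_support] at hd
              rcases List.mem_cons.1 hd with h | h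
              · exact absurd h.symm hwv
              · exact h
            have := hnd.support_nodup
            rw [SimpleGraph.Walk.support_append] at this
            exact List.disjoint_of_nodup_append this ht hd'
          refine ⟨(p.takeUntil w hw).reverse.concat has, fun x hx => ?_⟩
          simp only [SimpleGraph.Walk.support_concat, List.mem_append,
            List.mem_singleton, SimpleGraph.Walk.support_reverse, List.mem_reverse] at hx
          rcases hx with hx | rfl
          · exact ⟨Or.inr (p.support_takeUntil_subset_support hw hx), fun e => ht (e ▸ hx)⟩
          · exact ⟨by simp, fun h => hvs h.symm⟩
        · refine ⟨(p.dropUntil w hw).concat hbs, fun x hx => ?_⟩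
          simp only [SimpleGraph.Walk.support_concat, List.mem_append,
            List.mem_singleton] at hx
          rcases hx with hx | rfl
          · exact ⟨Or.inr (p.support_dropUntil_subset_support hw hx), fun e => hd (e ▸ hx)⟩
          · exact ⟨by simp, fun h => hvs h.symm⟩

variable [Finite V]

theorem exists_maximal_set_of_prop {p : Set V → Prop} {B : Set V} (hB : p B) :
    ∃ M, B ⊆ M ∧ Maximal p M :=
  (Set.toFinite {M : Set V | p M}).exists_le_maximal hB

/-- In a block graph, two neighbours of `s` that are joined by a walk avoiding `s` are adjacent. -/
theorem IsBlockGraph.adj_of_reachableAvoiding (hblock : IsBlockGraph G) {s a b : V}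
    (has : G.Adj a s) (hbs : G.Adj b s) (hab : a ≠ b) (h : ReachableAvoiding G s a b) :
    G.Adj a b := by
  obtain ⟨p, hp, hs⟩ := h.exists_isPath
  -- The path closed up through `s` is biconnected, so it lies in a block, and blocks are cliques.
  obtain ⟨M, hBM, hM⟩ :=
    exists_maximal_set_of_prop (isBiconnected_insert_support has hbs hp hs)
  exact hblock M hM (hBM (Or.inr p.start_mem_support)) (hBM (Or.inr p.end_mem_support)) hab

/-- In a block graph, removing `s` disconnects any two distinct maximal cliques containing `s`. -/
theorem IsBlockGraph.maxClique_eq_of_reachableAvoiding (hblock : IsBlockGraph G)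
    {C D : MaxClique G} {s a b : V} (hsC : s ∈ C.1) (hsD : s ∈ D.1) (ha : a ∈ C.1 \ {s})
    (hb : b ∈ D.1 \ {s}) (h : ReachableAvoiding G s a b) : C = D := by
  have hC := C.2.prop
  have hD := D.2.prop
  -- If the two cliques stayed joined without `s`, their union would be a clique, and maximality
  -- makes both equal to it.
  have hcross : ∀ x ∈ C.1, ∀ y ∈ D.1, x ≠ y → G.Adj x y := by
    intro x hx y hy hxy
    by_cases hxs : x = s
    · subst hxs; exact hD hsD hy hxy
    by_cases hys : y = s
    · subst hys; exact hC hx hsC hxy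
    have h1 : ReachableAvoiding G s x a :=
      .of_isClique hC hx ha.1 (Ne.symm hxs) (Ne.symm ha.2)
    have h2 : ReachableAvoiding G s b y :=
      .of_isClique hD hb.1 hy (Ne.symm hb.2) (Ne.symm hys)
    exact hblock.adj_of_reachableAvoiding (hC hx hsC hxs) (hD hy hsD hys) hxy
      ((h1.trans h).trans h2)
  have hU : G.IsClique (C.1 ∪ D.1) := by
    rintro x (hx | hx) y (hy | hy) hxy
    · exact hC hx hy hxy
    · exact hcross x hx y hy hxy
    · exact (hcross y hy x hx hxy.symm).symm
    · exact hD hx hy hxy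
  apply Subtype.ext
  exact (C.2.eq_of_subset hU Set.subset_union_left).trans
    (D.2.eq_of_subset hU Set.subset_union_right).symm

theorem IsBlockGraph.maxClique_eq_of_mem (hblock : IsBlockGraph G) {C D : MaxClique G} {a b : V}
    (hab : a ≠ b) (haC : a ∈ C.1) (haD : a ∈ D.1) (hbC : b ∈ C.1) (hbD : b ∈ D.1) : C = D :=
  hblock.maxClique_eq_of_reachableAvoiding haC haD ⟨hbC, hab.symm⟩ ⟨hbD, hab.symm⟩ (.refl hab)

theorem exists_maxClique_of_adj {a b : V} (h : G.Adj a b) :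
    ∃ C : MaxClique G, a ∈ C.1 ∧ b ∈ C.1 := by
  have : G.IsClique {a, b} := by
    rw [SimpleGraph.isClique_pair]
    exact fun _ => h
  obtain ⟨M, hM, hmax⟩ := exists_maximal_set_of_prop this
  exact ⟨⟨M, hmax⟩, hM (by simp), hM (by simp)⟩

omit [Finite V] in
theorem exists_adj_dist_add_one (hG : G.Connected) {u v : V} (h : u ≠ v) :
    ∃ w, G.Adj w v ∧ G.dist u w + 1 = G.dist u v := by
  obtain ⟨p, hp⟩ := hG.exists_walk_length_eq_dist v u
  cases p with
  | nil => exact absurd rfl h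
  | @cons _ w _ hadj q =>
    refine ⟨w, hadj.symm, ?_⟩
    have h1 : G.dist w u ≤ q.length := SimpleGraph.dist_le q
    have h2 := hG.dist_triangle (u := v) (v := w) (w := u)
    have h3 : G.dist v w = 1 := SimpleGraph.dist_eq_one_iff_adj.2 hadj
    rw [SimpleGraph.Walk.length_cons] at hp
    rw [SimpleGraph.dist_comm (u := u), SimpleGraph.dist_comm (u := u)]
    omega

omit [Finite V] in
theorem dist_add_dist_of_mem_support {u v w : V} (hG : G.Connected) {p : G.Walk u v}
    (hp : p.length = G.dist u v) (hw : w ∈ p.support) : G.dist u w + G.dist w v = G.dist u v := by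
  classical
  have h1 := SimpleGraph.dist_le (p.takeUntil w hw)
  have h2 := SimpleGraph.dist_le (p.dropUntil w hw)
  have h3 := congrArg SimpleGraph.Walk.length (p.take_spec hw)
  rw [SimpleGraph.Walk.length_append] at h3
  have h4 := hG.dist_triangle (u := u) (v := w) (w := v)
  omega

/-- The node of `C` nearest to `u` works. If a walk from `u` into `C` avoided it, the preceding node
`w` on a shortest path from `u` to it would be joined to all other nodes of `C` by walks avoiding
`s`, hence adjacent to all of `C`, against maximality. -/
theorem IsBlockGraph.exists_isSepNode (hG : G.Connected) (hblock : IsBlockGraph G) (u : V)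
    (C : MaxClique G) : ∃ s, IsSepNode G u C.1 s := by
  classical
  have hne : C.1.Nonempty := by
    by_contra h
    rw [Set.not_nonempty_iff_eq_empty] at h
    have := C.2.eq_of_subset (t := {u}) (by simp) (by simp [h])
    rw [h] at this
    exact Set.singleton_ne_empty u this.symm
  obtain ⟨s, hsC, hs⟩ := Set.exists_min_image C.1 (G.dist u) (Set.toFinite _) hne
  refine ⟨s, hsC, fun v hv p _ => ?_⟩
  by_contra hsp
  have hsv : s ≠ v := fun h => hsp (h ▸ p.end_mem_support)
  have hsu : u ≠ s := fun h => hsp (h ▸ p.start_mem_support)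
  obtain ⟨w, hws, hdw⟩ := exists_adj_dist_add_one hG hsu
  have hwC : w ∉ C.1 := fun h => by have := hs w h; omega
  have hw : ReachableAvoiding G s u w := by
    obtain ⟨q, hq⟩ := hG.exists_walk_length_eq_dist u w
    refine ⟨q, fun h => ?_⟩
    have := dist_add_dist_of_mem_support hG hq h
    omega
  have hwv : ReachableAvoiding G s w v := hw.symm.trans ⟨p, hsp⟩
  have hcl : G.IsClique (insert w C.1) := by
    refine C.2.prop.insert fun x hx hwx => ?_
    by_cases hxs : x = s
    · subst hxs; exact hws
    · exact hblock.adj_of_reachableAvoiding hws (C.2.prop hx hsC hxs) hwx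
        (hwv.trans (.of_isClique C.2.prop hv hx hsv (Ne.symm hxs)))
  have := C.2.eq_of_subset hcl (Set.subset_insert _ _)
  exact hwC (this ▸ Set.mem_insert _ _)

variable (hG : G.Connected) (hblock : IsBlockGraph G)
include hG hblock

theorem isSepNode_sepNode (u : V) (C : MaxClique G) : IsSepNode G u C.1 (sepNode G u C.1) := by
  have h := hblock.exists_isSepNode hG u C
  rw [sepNode, dif_pos h]
  exact h.choose_spec

theorem sepNode_mem (u : V) (C : MaxClique G) : sepNode G u C.1 ∈ C.1 :=
  (isSepNode_sepNode hG hblock u C).1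

theorem sepNode_mem_support {u v : V} {C : MaxClique G} (hv : v ∈ C.1) (p : G.Walk u v) :
    sepNode G u C.1 ∈ p.support := by
  classical
  exact p.support_bypass_subset_support
    ((isSepNode_sepNode hG hblock u C).2 v hv p.bypass p.bypass_isPath)

theorem dist_eq_dist_sepNode_add_one {u v : V} {C : MaxClique G}
    (hv : v ∈ C.1 \ {sepNode G u C.1}) : G.dist u v = G.dist u (sepNode G u C.1) + 1 := by
  obtain ⟨p, hp⟩ := hG.exists_walk_length_eq_dist u v
  have h1 := dist_add_dist_of_mem_support hG hp (sepNode_mem_support hG hblock hv.1 p)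
  have hadj := C.2.prop (sepNode_mem hG hblock u C) hv.1 (Ne.symm hv.2)
  rw [SimpleGraph.dist_eq_one_iff_adj.2 hadj] at h1
  exact h1.symm

/-- The node before `v` on a shortest path from `u` to `v` is the separator node of the clique. -/
theorem eq_sepNode_of_adj {u v w : V} {C : MaxClique G} (hv : v ∈ C.1 \ {sepNode G u C.1})
    (hw : G.Adj w v) (hd : G.dist u w + 1 = G.dist u v) : w = sepNode G u C.1 := by
  obtain ⟨p, hp⟩ := hG.exists_walk_length_eq_dist u w
  have h1 := sepNode_mem_support hG hblock hv.1 (p.concat hw)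
  simp only [SimpleGraph.Walk.support_concat, List.mem_append,
    List.mem_singleton] at h1
  rcases h1 with h1 | h1
  · have h2 := dist_add_dist_of_mem_support hG hp h1
    have h3 := dist_eq_dist_sepNode_add_one hG hblock hv
    have h4 : G.dist (sepNode G u C.1) w = 0 := by omega
    exact ((hG.dist_eq_zero_iff).1 h4).symm
  · exact absurd h1.symm hv.2

theorem sepNode_adj {u v : V} {C : MaxClique G} (hv : v ∈ C.1 \ {sepNode G u C.1}) :
    G.Adj (sepNode G u C.1) v :=
  C.2.prop (sepNode_mem hG hblock u C) hv.1 (Ne.symm hv.2)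

/-- Both separator nodes are the predecessor of `v` as seen from `u`, so the cliques share two
nodes. With `exists_mem_diff_sepNode`, the sets `C \ s` partition the nodes other than `u`. -/
theorem maxClique_eq_of_mem_diff {u v : V} {C D : MaxClique G}
    (hC : v ∈ C.1 \ {sepNode G u C.1}) (hD : v ∈ D.1 \ {sepNode G u D.1}) : C = D := by
  have h := eq_sepNode_of_adj hG hblock hC (sepNode_adj hG hblock hD)
    (dist_eq_dist_sepNode_add_one hG hblock hD).symm
  exact hblock.maxClique_eq_of_mem (Ne.symm hC.2) (sepNode_mem hG hblock u C)
    (h ▸ sepNode_mem hG hblock u D) hC.1 hD.1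

theorem exists_mem_diff_sepNode {u v : V} (h : u ≠ v) :
    ∃ C : MaxClique G, v ∈ C.1 \ {sepNode G u C.1} := by
  obtain ⟨w, hw, hd⟩ := exists_adj_dist_add_one hG h
  obtain ⟨C, hwC, hvC⟩ := exists_maxClique_of_adj hw
  refine ⟨C, hvC, fun hv => ?_⟩
  have hw' : w ∈ C.1 \ {sepNode G u C.1} := ⟨hwC, by
    rw [← Set.mem_singleton_iff.1 hv]; exact hw.ne⟩
  have := dist_eq_dist_sepNode_add_one hG hblock hw'
  rw [← Set.mem_singleton_iff.1 hv] at this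
  omega

theorem ne_of_mem_diff_sepNode {u v : V} {C : MaxClique G}
    (hv : v ∈ C.1 \ {sepNode G u C.1}) : u ≠ v := by
  rintro rfl
  have := dist_eq_dist_sepNode_add_one hG hblock hv
  simp at this

/-- The last step of a shortest walk is forced: it starts at the separator node of the clique that
contains `v` as a non-separator node. -/
theorem walk_eq_of_length_eq_dist {u v : V} (p q : G.Walk u v) (hp : p.length = G.dist u v)
    (hq : q.length = G.dist u v) : p = q := by
  induction hn : G.dist u v generalizing v with
  | zero =>
    rw [hn] at hp hq
    have := SimpleGraph.Walk.eq_of_length_eq_zero hp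
    subst this
    rw [SimpleGraph.Walk.length_eq_zero_iff] at hp hq
    rw [hp.eq_nil, hq.eq_nil]
  | succ n ih =>
    have huv : u ≠ v := by
      rintro rfl
      simp at hn
    obtain ⟨C, hC⟩ := exists_mem_diff_sepNode hG hblock huv
    have key : ∀ r : G.Walk u v, r.length = G.dist u v →
        ∃ r' : G.Walk u (sepNode G u C.1), r'.length = G.dist u (sepNode G u C.1) ∧
          r = r'.concat (sepNode_adj hG hblock hC) := by
      intro r hr
      cases r with
      | nil => exact absurd rfl huv
      | cons h r =>
        obtain ⟨w, r', h', he⟩ := SimpleGraph.Walk.exists_cons_eq_concat h r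
        rw [he] at hr ⊢
        rw [SimpleGraph.Walk.length_concat] at hr
        have h1 := SimpleGraph.dist_le r'
        have h2 := hG.dist_triangle (u := u) (v := w) (w := v)
        rw [SimpleGraph.dist_eq_one_iff_adj.2 h'] at h2
        have hw := eq_sepNode_of_adj hG hblock hC h' (by omega)
        subst hw
        exact ⟨r', by omega, rfl⟩
    obtain ⟨p', hp', rfl⟩ := key p hp
    obtain ⟨q', hq', rfl⟩ := key q hq
    have hd := dist_eq_dist_sepNode_add_one hG hblock hC
    rw [ih p' q' hp' hq' (by omega)]

omit [Finite V] hblock in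
theorem length_shortestPath (u v : V) : (shortestPath hG u v).length = G.dist u v :=
  (hG.exists_walk_length_eq_dist u v).choose_spec

theorem shortestPath_eq_concat {u v : V} {C : MaxClique G}
    (hv : v ∈ C.1 \ {sepNode G u C.1}) :
    shortestPath hG u v =
      (shortestPath hG u (sepNode G u C.1)).concat (sepNode_adj hG hblock hv) := by
  apply walk_eq_of_length_eq_dist hG hblock
  · exact length_shortestPath hG u v
  · rw [SimpleGraph.Walk.length_concat, length_shortestPath,
      dist_eq_dist_sepNode_add_one hG hblock hv]

omit [Finite V] hblock in
theorem shortestPath_self (u : V) : shortestPath hG u u = .nil := by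
  have := length_shortestPath hG u u
  rw [SimpleGraph.dist_self, SimpleGraph.Walk.length_eq_zero_iff] at this
  exact this.eq_nil

theorem eq_sepNode_of_mem_support_shortestPath {u w : V} {C : MaxClique G}
    (hw : w ∈ (shortestPath hG u (sepNode G u C.1)).support) (hC : w ∈ C.1) :
    w = sepNode G u C.1 := by
  by_contra hne
  have h1 := dist_eq_dist_sepNode_add_one hG hblock (u := u) (C := C) ⟨hC, hne⟩
  have h2 := dist_add_dist_of_mem_support hG (length_shortestPath hG _ _) hw
  omega

omit hG in
theorem mem_separatorNodes {C D : MaxClique G} (hCD : C ≠ D) {s : V} (hC : s ∈ C.1)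
    (hD : s ∈ D.1) : s ∈ separatorNodes G := by
  refine ⟨C, D, hCD, ?_, ?_⟩
  · intro a ha b hb p _
    by_contra hcon
    simp only [Set.mem_singleton_iff, exists_eq_right] at hcon
    exact hCD (hblock.maxClique_eq_of_reachableAvoiding hC hD
      ⟨ha, fun h => hcon (Set.mem_singleton_iff.1 h ▸ p.start_mem_support)⟩
      ⟨hb, fun h => hcon (Set.mem_singleton_iff.1 h ▸ p.end_mem_support)⟩ ⟨p, hcon⟩)
  · intro T hT _
    -- The trivial walk at `s` already joins `C` to `D`, so every separator contains `s`.
    obtain ⟨w, hw, hwT⟩ := hT s hC s hD .nil .nil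
    simp only [SimpleGraph.Walk.support_nil, List.mem_singleton] at hw
    simpa [hw] using hwT

omit hG hblock in
/-- The nodes covered by the cliques in `𝒟`, apart from the separator nodes of these cliques,
together with the root `u`. -/
def coveredNodes (G : SimpleGraph V) (u : V) (𝒟 : Set (MaxClique G)) : Set V :=
  {v | v = u ∨ ∃ D ∈ 𝒟, v ∈ D.1 \ {sepNode G u D.1}}

/-- This is the separation to which the Markov property is applied. The shortest path from `u` to
`a` must pass through `s`, or `u` would reach `b` without `s`. As the clique of `a` has a separator
node no farther than `s`, the node `a` is one step beyond `s` and its clique also hangs at `s`;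
being joined to `C` without `s`, it equals `C`. -/
theorem reachableAvoiding_sepNode_false {u : V} {𝒟 : Set (MaxClique G)} {C : MaxClique G}
    (hC : C ∉ 𝒟) (hle : ∀ D ∈ 𝒟, G.dist u (sepNode G u D.1) ≤ G.dist u (sepNode G u C.1))
    {a b : V} (ha : a ∈ coveredNodes G u 𝒟)
    (hb : b ∈ C.1 \ {sepNode G u C.1}) (h : ReachableAvoiding G (sepNode G u C.1) a b) :
    False := by
  set s := sepNode G u C.1
  have key : s ∈ (shortestPath hG u a).support := by
    by_contra hs
    obtain ⟨p, hp⟩ := ReachableAvoiding.trans ⟨_, hs⟩ h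
    exact hp (sepNode_mem_support hG hblock hb.1 p)
  have has : s ≠ a := by
    obtain ⟨p, hp⟩ := h
    exact fun e => hp (e ▸ p.start_mem_support)
  have hd := dist_add_dist_of_mem_support hG (length_shortestPath hG _ _) key
  have hpos := hG.pos_dist_of_ne has
  rcases ha with rfl | ⟨D, hD, haD⟩
  · rw [SimpleGraph.dist_comm, SimpleGraph.dist_self] at hd
    omega
  · have h1 := hle D hD
    have h2 := dist_eq_dist_sepNode_add_one hG hblock haD
    have h3 : G.dist s a = 1 := by omega
    have h4 := eq_sepNode_of_adj hG hblock haD (SimpleGraph.dist_eq_one_iff_adj.1 h3) (by omega)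
    refine hC ?_
    rw [← hblock.maxClique_eq_of_reachableAvoiding (C := D) (s := s)
      (h4 ▸ sepNode_mem hG hblock u D) (sepNode_mem hG hblock u C) (h4 ▸ haD) hb h]
    exact hD

end Graph

end

/-! ### Products of increments along shortest paths, and their independence. -/

section

/-- Since `g` ignores coordinate `i`, it factors through the other coordinates, which are
independent of that one under a product measure. -/
theorem map_prodMk_eval_pi {ι : Type*} [Fintype ι] {E : ι → Type*} [∀ i, MeasurableSpace (E i)]
    {μ : (i : ι) → Measure (E i)} [∀ i, IsProbabilityMeasure (μ i)] {F : Type*}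
    [MeasurableSpace F] {g : ((i : ι) → E i) → F} (hg : Measurable g) (i : ι)
    (h : ∀ z z', (∀ j, j ≠ i → z j = z' j) → g z = g z') :
    (Measure.pi μ).map (fun z => (g z, z i)) = ((Measure.pi μ).map g).prod (μ i) := by
  classical
  have hne : Nonempty (E i) := nonempty_of_isProbabilityMeasure (μ i)
  have hind : iIndepFun (fun j (z : (i : ι) → E i) => z j) (Measure.pi μ) :=
    iIndepFun_pi (X := fun _ x => x) fun _ => aemeasurable_id
  have hST : Disjoint (Finset.univ.erase i) {i} := by simp
  have hi := hind.indepFun_finset _ _ hST fun j => measurable_pi_apply j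
  obtain ⟨y⟩ := hne
  -- Coordinate `i` is filled with an arbitrary point `y`, which `g` does not see.
  let φ : ((j : ↥(Finset.univ.erase i)) → E j) → (j : ι) → E j := fun r j =>
    if hj : j = i then hj ▸ y else r ⟨j, by simp [hj]⟩
  have hφ : Measurable φ := by
    refine measurable_pi_lambda _ fun j => ?_
    by_cases hj : j = i
    · simp only [φ, hj, dite_true]
      exact measurable_const
    · simp only [φ, hj, dite_false]
      exact measurable_pi_apply _
  let ψ : ((j : ↥({i} : Finset ι)) → E j) → E i := fun r => r ⟨i, Finset.mem_singleton_self i⟩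
  have hψ : Measurable ψ := measurable_pi_apply (⟨i, Finset.mem_singleton_self i⟩ : ({i} : Finset ι))
  have hi' := hi.comp (hg.comp hφ) hψ
  have he : (g ∘ φ) ∘ (fun (z : (i : ι) → E i) (j : ↥(Finset.univ.erase i)) => z j) = g := by
    funext z
    refine h _ _ fun j hj => ?_
    simp [φ, hj]
  rw [he, indepFun_iff_map_prod_eq_prod_map_map hg.aemeasurable
    (Measurable.aemeasurable (by exact measurable_pi_apply i))] at hi'
  refine hi'.trans ?_
  congr 1
  exact (measurePreserving_eval μ i).map_eq

variable {V : Type u} [Finite V] {G : SimpleGraph V}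

variable (hG : G.Connected) (hblock : IsBlockGraph G)

theorem pathProduct_self (u : V) (z : IncrementSpace G u) : pathProduct hG u u z = 1 := by
  simp [pathProduct, shortestPath_self]

include hblock

include hG in
theorem increment_sepNode {u v : V} {C : MaxClique G} (hv : v ∈ C.1 \ {sepNode G u C.1})
    (z : IncrementSpace G u) : increment u (sepNode G u C.1) v z = z C ⟨v, hv⟩ := by
  have h : ∃ D : MaxClique G, sepNode G u D.1 = sepNode G u C.1 ∧ v ∈ D.1 \ {sepNode G u D.1} :=
    ⟨C, rfl, hv⟩
  rw [increment, dif_pos h]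
  have key : ∀ (D : MaxClique G) (hD : v ∈ D.1 \ {sepNode G u D.1}),
      z D ⟨v, hD⟩ = z C ⟨v, hv⟩ := by
    intro D hD
    obtain rfl := maxClique_eq_of_mem_diff hG hblock hD hv
    rfl
  exact key _ _

theorem darts_shortestPath {u v : V} {C : MaxClique G} (hv : v ∈ C.1 \ {sepNode G u C.1}) :
    (shortestPath hG u v).darts = (shortestPath hG u (sepNode G u C.1)).darts ++
      [⟨(sepNode G u C.1, v), sepNode_adj hG hblock hv⟩] := by
  rw [shortestPath_eq_concat hG hblock hv, SimpleGraph.Walk.darts_concat, List.concat_eq_append]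

theorem pathProduct_eq_mul {u v : V} {C : MaxClique G} (hv : v ∈ C.1 \ {sepNode G u C.1})
    (z : IncrementSpace G u) :
    pathProduct hG u v z = pathProduct hG u (sepNode G u C.1) z * z C ⟨v, hv⟩ := by
  rw [pathProduct, darts_shortestPath hG hblock hv]
  simp [pathProduct, increment_sepNode hG hblock hv]

/-- Each edge of the path to `v` belongs to a clique whose separator node is strictly closer to `u`
than `v`, so the sub-vector of `C` does not enter the product. -/
theorem pathProduct_congr_of_dist_le {u v : V} {C : MaxClique G}
    (hd : G.dist u v ≤ G.dist u (sepNode G u C.1)) {z z' : IncrementSpace G u}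
    (hz : ∀ D, D ≠ C → z D = z' D) : pathProduct hG u v z = pathProduct hG u v z' := by
  induction hn : G.dist u v using Nat.strong_induction_on generalizing v with
  | _ n ih =>
    by_cases huv : u = v
    · subst huv; simp [pathProduct_self]
    · obtain ⟨D, hD⟩ := exists_mem_diff_sepNode hG hblock huv
      have h1 := dist_eq_dist_sepNode_add_one hG hblock hD
      have hDC : D ≠ C := by
        rintro rfl
        omega
      rw [pathProduct_eq_mul hG hblock hD, pathProduct_eq_mul hG hblock hD, hz D hDC,
        ih (G.dist u (sepNode G u D.1)) (by omega) (by omega) rfl]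

theorem pathProduct_congr {u v : V} {𝒟 : Set (MaxClique G)} {C : MaxClique G}
    (hC : C ∉ 𝒟) (hle : ∀ D ∈ 𝒟, G.dist u (sepNode G u D.1) ≤ G.dist u (sepNode G u C.1))
    (hv : v ∈ coveredNodes G u 𝒟) {z z' : IncrementSpace G u}
    (hz : ∀ D, D ≠ C → z D = z' D) : pathProduct hG u v z = pathProduct hG u v z' := by
  rcases hv with rfl | ⟨D, hD, hv⟩
  · simp [pathProduct_self]
  · rw [pathProduct_eq_mul hG hblock hv, pathProduct_eq_mul hG hblock hv,
      hz D (fun h => hC (h ▸ hD)), pathProduct_congr_of_dist_le hG hblock (hle D hD) hz]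

/-- If `A_{uv}` has an atom at zero, then so has the increment along some edge of the path. -/
theorem exists_dart_of_pathProduct_eq_zero
    (ν : (C : MaxClique G) → (s : V) → ProbabilityMeasure (↥(C.1 \ {s}) → ℝ≥0)) {u v : V}
    (h : (incrementLaw ν u : Measure (IncrementSpace G u)) {z | pathProduct hG u v z = 0} ≠ 0) :
    ∃ e ∈ (shortestPath hG u v).darts, ∃ C' : MaxClique G,
      e.fst ∈ C'.1 ∧ ∃ hb : e.snd ∈ C'.1 \ {e.fst},
        0 < ((ν C' e.fst : Measure (↥(C'.1 \ {e.fst}) → ℝ≥0)).map fun y => y ⟨e.snd, hb⟩) {0} := by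
  induction hn : G.dist u v using Nat.strong_induction_on generalizing v with
  | _ n ih =>
    by_cases huv : u = v
    · subst huv; simp [pathProduct_self] at h
    · obtain ⟨D, hD⟩ := exists_mem_diff_sepNode hG hblock huv
      have h1 := dist_eq_dist_sepNode_add_one hG hblock hD
      rw [darts_shortestPath hG hblock hD]
      -- The product vanishes only if the product up to the separator node or the last increment
      -- does. If the former is almost surely nonzero, the last increment has the atom; otherwise
      -- descend.
      by_cases h2 : (incrementLaw ν u : Measure (IncrementSpace G u))
          {z | pathProduct hG u (sepNode G u D.1) z = 0} = 0
      · refine ⟨_, List.mem_append_right _ (List.mem_singleton_self _), D,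
          sepNode_mem hG hblock u D, hD, ?_⟩
        have h3 : (incrementLaw ν u : Measure (IncrementSpace G u))
            {z | z D ⟨v, hD⟩ = 0} ≠ 0 := by
          intro h3
          refine h (measure_mono_null (fun z hz => ?_) (measure_union_null h2 h3))
          rw [Set.mem_ofPred_eq, pathProduct_eq_mul hG hblock hD, mul_eq_zero] at hz
          exact hz
        have h4 : (incrementLaw ν u : Measure (IncrementSpace G u)).map (fun z => z D) =
            (ν D (sepNode G u D.1) : Measure _) :=
          (measurePreserving_eval (fun C : MaxClique G =>
            (ν C (sepNode G u C.1) : Measure (↥(C.1 \ {sepNode G u C.1}) → ℝ≥0))) D).map_eq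
        dsimp only
        rw [← h4, Measure.map_map (measurable_pi_apply _) (measurable_pi_apply _),
          Measure.map_apply ((measurable_pi_apply _).comp (measurable_pi_apply _))
            (measurableSet_singleton _)]
        exact pos_iff_ne_zero.2 h3
      · obtain ⟨e, he, hrest⟩ := ih _ (by omega) h2 rfl
        exact ⟨e, List.mem_append_left _ he, hrest⟩

end

/-! ### Two tools on weak convergence. -/

section

/-- An extended continuous mapping theorem: integrals of `H i` with respect to weakly convergent
laws converge to the integral of `h` if, locally around almost every point of the limit law, the
functions `H i` are eventually close to `h`. -/
theorem tendsto_integral_of_locally_close {S : Type*} [TopologicalSpace S] [MeasurableSpace S]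
    [OpensMeasurableSpace S] [SecondCountableTopology S] [HasOuterApproxClosed S] {ι : Type*}
    {L : Filter ι} {μs : ι → ProbabilityMeasure S} {μ : ProbabilityMeasure S}
    (hμ : Tendsto μs L (𝓝 μ)) {H : ι → S → ℝ}
    (hH : ∀ i, AEStronglyMeasurable (H i) (μs i : Measure S)) (h : S →ᵇ ℝ) {M : ℝ}
    (hM : ∀ i x, |H i x| ≤ M)
    (hloc : ∀ ε > 0, ∀ᵐ x ∂(μ : Measure S), ∃ U ∈ 𝓝 x, ∀ᶠ i in L, ∀ᵐ y ∂(μs i : Measure S),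
      y ∈ U → |H i y - h y| ≤ ε) :
    Tendsto (fun i => ∫ x, H i x ∂(μs i : Measure S)) L (𝓝 (∫ x, h x ∂(μ : Measure S))) := by
  have hh := ProbabilityMeasure.tendsto_iff_forall_integral_tendsto.1 hμ h
  have hM0 : 0 ≤ M ∨ IsEmpty ι := by
    rcases isEmpty_or_nonempty ι with h | ⟨⟨i⟩⟩
    · exact Or.inr h
    · obtain ⟨x⟩ := nonempty_of_isProbabilityMeasure (μ : Measure S)
      exact Or.inl ((abs_nonneg _).trans (hM i x))
  rcases hM0 with hM0 | hι
  swap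
  · rw [Filter.filter_eq_bot_of_isEmpty L]; exact tendsto_bot
  have hdiff : Tendsto (fun i => ∫ x, H i x ∂(μs i : Measure S) - ∫ x, h x ∂(μs i : Measure S)) L
      (𝓝 0) := by
    rw [Metric.tendsto_nhds]
    intro ε' hε'
    set K : ℝ := 1 + (M + ‖h‖)
    have hK : 0 < K := by positivity
    obtain ⟨ε, hε, hεK⟩ : ∃ ε > 0, ε * K < ε' :=
      ⟨ε' / (2 * K), by positivity, by field_simp; norm_num⟩
    -- These sets are stable under finite unions and together have full `μ`-measure. By second
    -- countability one finite union has `μ`-measure above `1 - ε`, and by the portmanteau theorem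
    -- so do eventually the laws `μs i`. Off it the crude bound `M + ‖h‖` is used.
    let 𝒰 : Set (Set S) := {U | IsOpen U ∧ ∀ᶠ i in L, ∀ᵐ y ∂(μs i : Measure S),
      y ∈ U → |H i y - h y| ≤ ε}
    have hempty : ∅ ∈ 𝒰 := ⟨isOpen_empty, by simp⟩
    have hunion : ∀ U ∈ 𝒰, ∀ W ∈ 𝒰, U ∪ W ∈ 𝒰 := by
      rintro U ⟨hU, hU'⟩ W ⟨hW, hW'⟩
      refine ⟨hU.union hW, ?_⟩
      filter_upwards [hU', hW'] with i h1 h2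
      filter_upwards [h1, h2] with y h1 h2
      rintro (hy | hy)
      exacts [h1 hy, h2 hy]
    obtain ⟨T, hTc, hT𝒰, hT⟩ := TopologicalSpace.isOpen_sUnion_countable 𝒰 fun U hU => hU.1
    obtain ⟨f, hf⟩ := (hTc.insert ∅).exists_eq_range (Set.insert_nonempty _ _)
    have hf𝒰 : ∀ n, f n ∈ 𝒰 := by
      intro n
      have : f n ∈ insert ∅ T := hf ▸ Set.mem_range_self n
      rcases this with h | h
      · rw [h]; exact hempty
      · exact hT𝒰 h
    have hacc : ∀ n, Set.accumulate f n ∈ 𝒰 := by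
      intro n
      induction n with
      | zero => simpa [Set.accumulate_zero_nat] using hf𝒰 0
      | succ n ih => rw [Set.accumulate_succ]; exact hunion _ ih _ (hf𝒰 _)
    have hfull : (μ : Measure S) (⋃ n, f n) = 1 := by
      have h1 : ⋃ n, f n = ⋃₀ 𝒰 := by
        rw [← Set.sUnion_range, ← hf, Set.sUnion_insert, Set.empty_union, hT]
      rw [h1, ← measure_univ (μ := (μ : Measure S))]
      refine measure_congr (eventuallyEq_univ.2 ?_)
      filter_upwards [hloc ε hε] with x hx
      obtain ⟨U, hU, hev⟩ := hx
      obtain ⟨W, hWU, hW, hxW⟩ := mem_nhds_iff.1 hU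
      refine ⟨W, ⟨hW, ?_⟩, hxW⟩
      filter_upwards [hev] with i hi
      filter_upwards [hi] with y hy hyW using hy (hWU hyW)
    have hlim := tendsto_measure_iUnion_accumulate (μ := (μ : Measure S)) (f := f)
    rw [hfull] at hlim
    have hlt : (1 - ENNReal.ofReal ε) < 1 :=
      ENNReal.sub_lt_self ENNReal.one_ne_top one_ne_zero (by simpa using hε)
    obtain ⟨n, hn⟩ := (hlim.eventually (lt_mem_nhds hlt)).exists
    set U := Set.accumulate f n
    have hUo : IsOpen U := (hacc n).1
    have hlow : ∀ᶠ i in L, 1 - ENNReal.ofReal ε < (μs i : Measure S) U :=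
      eventually_lt_of_lt_liminf
        (hn.trans_le (ProbabilityMeasure.le_liminf_measure_open_of_tendsto hμ hUo))
    filter_upwards [hlow, (hacc n).2] with i hi1 hi2
    have hcompl : (μs i : Measure S).real Uᶜ ≤ ε := by
      rw [Measure.real, prob_compl_eq_one_sub hUo.measurableSet]
      refine ENNReal.toReal_le_of_le_ofReal hε.le ?_
      exact tsub_le_iff_left.2 (tsub_le_iff_right.1 hi1.le)
    have hHint : Integrable (H i) (μs i : Measure S) :=
      Integrable.of_bound (hH i) M (ae_of_all _ fun x => by simpa using hM i x)
    have hhint : Integrable h (μs i : Measure S) := h.integrable _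
    rw [← integral_sub hHint hhint, dist_zero_right]
    have hbound : ∀ᵐ y ∂(μs i : Measure S),
        ‖H i y - h y‖ ≤ ε + Uᶜ.indicator (fun _ => M + ‖h‖) y := by
      filter_upwards [hi2] with y hy
      by_cases hyU : y ∈ U
      · simpa [hyU] using hy hyU
      · have h1 := hM i y
        have h2 := h.norm_coe_le_norm y
        have h3 := norm_sub_le (H i y) (h y)
        rw [Real.norm_eq_abs (H i y)] at h3
        rw [Set.indicator_of_mem (by exact hyU)]
        linarith
    calc ‖∫ x, H i x - h x ∂(μs i : Measure S)‖
        ≤ ∫ y, ε + Uᶜ.indicator (fun _ => M + ‖h‖) y ∂(μs i : Measure S) :=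
          norm_integral_le_of_norm_le ((integrable_const _).add
            ((integrable_const _).indicator hUo.measurableSet.compl)) hbound
      _ = ε + (μs i : Measure S).real Uᶜ * (M + ‖h‖) := by
          rw [integral_add (integrable_const _)
            ((integrable_const _).indicator hUo.measurableSet.compl),
            integral_indicator hUo.measurableSet.compl]
          simp
      _ ≤ ε + ε * (M + ‖h‖) := by gcongr
      _ = ε * K := by ring
      _ < ε' := hεK
  simpa using hdiff.add hh

/-- The integral of a bounded continuous function with respect to one variable depends jointly
continuously on the other variable and on the law. -/
theorem continuous_integral_prod {S T : Type*} [TopologicalSpace S] [TopologicalSpace T]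
    [MeasurableSpace S] [MeasurableSpace T] [SecondCountableTopology S] [SecondCountableTopology T]
    [TopologicalSpace.PseudoMetrizableSpace S] [TopologicalSpace.PseudoMetrizableSpace T]
    [OpensMeasurableSpace S] [OpensMeasurableSpace T] (F : S × T →ᵇ ℝ) :
    Continuous fun p : S × ProbabilityMeasure T => ∫ y, F (p.1, y) ∂(p.2 : Measure T) := by
  -- Freezing one variable is integrating against a product with a Dirac mass, and products of laws
  -- are weakly continuous.
  have h1 : Continuous fun p : S × ProbabilityMeasure T => (diracProba p.1).prod p.2 :=
    ProbabilityMeasure.continuous_prod.comp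
      ((continuous_diracProba.comp continuous_fst).prodMk continuous_snd)
  rw [continuous_iff_continuousAt] at h1 ⊢
  intro p
  have h2 := ProbabilityMeasure.tendsto_iff_forall_integral_tendsto.1 (h1 p) F
  have key : ∀ q : S × ProbabilityMeasure T,
      ∫ y, F y ∂(((diracProba q.1).prod q.2 : ProbabilityMeasure (S × T)) : Measure (S × T)) =
        ∫ y, F (q.1, y) ∂(q.2 : Measure T) := by
    intro q
    have : (((diracProba q.1).prod q.2 : ProbabilityMeasure (S × T)) : Measure (S × T)) =
      (q.2 : Measure T).map (Prod.mk q.1) := Measure.dirac_prod _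
    rw [this, integral_map measurable_prodMk_left.aemeasurable
      F.continuous.measurable.aestronglyMeasurable]
  simpa only [key, ContinuousAt] using h2

end

/-! ### Conditional laws, exceptional null sets and the Markov property. -/

section

theorem map_compProd_comap {α β γ : Type*} [MeasurableSpace α] [MeasurableSpace β]
    [MeasurableSpace γ] (μ : Measure α) [SFinite μ] (κ : Kernel β γ) [IsSFiniteKernel κ]
    {φ : α → β} (hφ : Measurable φ) :
    (μ ⊗ₘ κ.comap φ hφ).map (Prod.map φ id) = μ.map φ ⊗ₘ κ := by
  refine Measure.ext_of_lintegral _ fun f hf => ?_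
  rw [lintegral_map hf (by fun_prop), Measure.lintegral_compProd (by fun_prop),
    Measure.lintegral_compProd hf, lintegral_map (hf.lintegral_kernel_prod_right') hφ]
  simp

variable {V : Type u} [Finite V] {G : SimpleGraph V} {P : Measure (V → ℝ≥0)}
  [IsProbabilityMeasure P]

omit [Finite V] [IsProbabilityMeasure P] in
theorem measurable_indicator_pi (W : Set V) :
    Measurable fun x : V → ℝ≥0 => W.indicator x := by
  refine measurable_pi_lambda _ fun v => ?_
  by_cases hv : v ∈ W
  · simpa [hv] using measurable_pi_apply v
  · simp [hv]

omit [Finite V] in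
theorem measurable_domRestrict (A : Set V) :
    Measurable (A.domRestrict (π := fun _ => ℝ≥0)) :=
  measurable_pi_lambda _ fun v => measurable_pi_apply v.1

/-- Uniform version of the near-zero assumption, with one exceptional null set for all `t`. -/
theorem SmallGivenSmall.exists_forall_ae {A : Set V} {s : V} (h : SmallGivenSmall P A s)
    {η : ℝ≥0} (hη : 0 < η) {ε : ℝ≥0∞} (hε : 0 < ε) :
    ∃ δ : ℝ≥0, 0 < δ ∧ ∃ T : ℝ≥0, ∀ᵐ z ∂margin P s, ∀ t : ℝ≥0, T ≤ t → z ≤ δ * t →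
      condLaw P A s z {y | ∃ v, η < y v / t} ≤ ε := by
  have h1 := eventually_lt_of_limsup_lt ((h η hη).trans_lt hε)
  obtain ⟨δ, h2, hδ⟩ := (h1.and self_mem_nhdsWithin).exists
  have h3 := eventually_lt_of_limsup_lt h2
  obtain ⟨T, hT⟩ := eventually_atTop.1 h3
  -- The null set of the essential supremum depends on `t`, so only integer `t` are used, and a
  -- general `t` is compared with its floor: `t ≤ 2 * ⌊t⌋₊` costs the factor 2 in `δ`, the event
  -- only grows when `t` is replaced by its floor, and the `+ 1` keeps the floor above `T` and `1`.
  refine ⟨δ / 2, half_pos hδ, max T 1 + 1, ?_⟩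
  have hn : ∀ n : ℕ, T ≤ n → 1 ≤ n → ∀ᵐ z ∂margin P s, z / n ≤ δ →
      condLaw P A s z {y | ∃ v, η < y v / n} < ε := by
    intro n hTn hn1
    have h4 := ae_lt_of_essSup_lt (hT n hTn)
    rw [ae_restrict_iff' measurableSet_Icc] at h4
    have h5 := ae_of_ae_map (by fun_prop) h4
    filter_upwards [h5] with z hz hzδ
    have hn0 : (n : ℝ≥0) ≠ 0 := by positivity
    have := hz ⟨zero_le, hzδ⟩
    rwa [mul_div_cancel₀ _ hn0] at this
  have hall : ∀ᵐ z ∂margin P s, ∀ n : ℕ, T ≤ n → 1 ≤ n → z / n ≤ δ →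
      condLaw P A s z {y | ∃ v, η < y v / n} < ε := by
    rw [ae_all_iff]
    intro n
    by_cases hTn : T ≤ n
    · by_cases hn1 : 1 ≤ n
      · filter_upwards [hn n hTn hn1] with z hz _ _ using hz
      · exact ae_of_all _ fun z _ h => absurd h hn1
    · exact ae_of_all _ fun z h => absurd h hTn
  filter_upwards [hall] with z hz t ht hzt
  have ht1 : (1 : ℝ≥0) ≤ t := (le_max_right T 1).trans (le_self_add.trans ht)
  have hfl : (⌊t⌋₊ : ℝ≥0) ≤ t := Nat.floor_le zero_le
  have hlt : t < ⌊t⌋₊ + 1 := Nat.lt_floor_add_one t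
  have hn1 : 1 ≤ ⌊t⌋₊ := Nat.le_floor (by exact_mod_cast ht1)
  have hn1' : (1 : ℝ≥0) ≤ ⌊t⌋₊ := by exact_mod_cast hn1
  have hTn : T ≤ ⌊t⌋₊ := by
    have : max T 1 + 1 < ⌊t⌋₊ + 1 := ht.trans_lt hlt
    exact (le_max_left T 1).trans (lt_of_add_lt_add_right this).le
  have hpos : (0 : ℝ≥0) < ⌊t⌋₊ := zero_lt_one.trans_le hn1'
  have hzn : z / ⌊t⌋₊ ≤ δ := by
    rw [div_le_iff₀ hpos]
    refine hzt.trans ?_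
    have : t ≤ 2 * ⌊t⌋₊ := hlt.le.trans (by rw [two_mul]; gcongr)
    calc δ / 2 * t ≤ δ / 2 * (2 * ⌊t⌋₊) := by gcongr
      _ = δ * ⌊t⌋₊ := by rw [← mul_assoc, div_mul_cancel₀ _ two_ne_zero]
  refine (measure_mono ?_).trans (hz _ hTn hn1 hzn).le
  rintro y ⟨v, hv⟩
  exact ⟨v, hv.trans_le (by gcongr)⟩

theorem CondTendsto.exists_forall_ae {A : Set V} {s : V} {ν : ProbabilityMeasure (A → ℝ≥0)}
    (h : CondTendsto P A s ν) {N : Set (ProbabilityMeasure (A → ℝ≥0))} (hN : N ∈ 𝓝 ν) :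
    ∃ R : ℝ≥0, ∀ᵐ r ∂margin P s, R ≤ r → scaledCondLaw P A s r ∈ N := by
  have h1 := h hN
  obtain ⟨S, hS, S', hS', hSS⟩ := mem_inf_iff_superset.1 (mem_map.1 h1)
  obtain ⟨R, hR⟩ := mem_atTop_sets.1 hS
  exact ⟨R, mem_of_superset hS' fun r hr hRr => hSS ⟨hR r hRr, hr⟩⟩

instance (s : V) : IsProbabilityMeasure (margin P s) :=
  Measure.isProbabilityMeasure_map (measurable_pi_apply s).aemeasurable

/-- The conditional law, given the coordinate `u`, of the field put to zero outside `W`. -/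
noncomputable def fieldKernel (P : Measure (V → ℝ≥0)) [IsProbabilityMeasure P] (W : Set V) (u : V) :
    Kernel ℝ≥0 (V → ℝ≥0) :=
  condDistrib (fun x : V → ℝ≥0 => W.indicator x) (fun x => x u) P

instance (W : Set V) (u : V) : IsMarkovKernel (fieldKernel P W u) := by
  unfold fieldKernel; infer_instance

theorem measurable_div_const_pi {A : Type*} (t : ℝ≥0) :
    Measurable fun (x : A → ℝ≥0) v => x v / t := by
  fun_prop

/-- The conditional law of the field divided by `t` and put to zero outside `W`, given that the
coordinate `u` has the value `t`. -/
noncomputable def scaledField (P : Measure (V → ℝ≥0)) [IsProbabilityMeasure P] (W : Set V) (u : V)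
    (t : ℝ≥0) : ProbabilityMeasure (V → ℝ≥0) :=
  ProbabilityMeasure.map ⟨fieldKernel P W u t, inferInstance⟩ (f := fun x v => x v / t)
    (measurable_div_const_pi t).aemeasurable

theorem toMeasure_scaledField (W : Set V) (u : V) (t : ℝ≥0) :
    (scaledField P W u t : Measure (V → ℝ≥0)) =
      (fieldKernel P W u t).map (fun x v => x v / t) := rfl

theorem margin_compProd_fieldKernel (W : Set V) (u : V) :
    margin P u ⊗ₘ fieldKernel P W u = P.map (fun x => (x u, W.indicator x)) :=
  compProd_map_condDistrib (measurable_indicator_pi W).aemeasurable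

/-- Almost sure properties of the coordinate `s` carry over to the conditional laws. -/
theorem ae_scaledField_of_ae_margin {W : Set V} {s : V} (hs : s ∈ W) (u : V) {p : ℝ≥0 → Prop}
    (hp : ∀ᵐ r ∂margin P s, p r) :
    ∀ᶠ t in atTop ⊓ ae (margin P u), ∀ᵐ x ∂(scaledField P W u t : Measure (V → ℝ≥0)),
      p (t * x s) := by
  obtain ⟨N, hpN, hN, hN0⟩ := exists_measurable_superset_of_null (ae_iff.1 hp)
  -- Under the joint law of `X_u` and the field, coordinate `s` almost surely avoids `N`;
  -- disintegrating, so it does under almost every conditional law.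
  have h1 : ∀ᵐ q ∂(margin P u ⊗ₘ fieldKernel P W u), q.2 s ∉ N := by
    rw [margin_compProd_fieldKernel, ae_map_iff
      ((measurable_pi_apply u).prodMk (measurable_indicator_pi W)).aemeasurable]
    · have : ∀ᵐ r ∂margin P s, r ∉ N := by rw [ae_iff]; simpa using hN0
      have := ae_of_ae_map (measurable_pi_apply s).aemeasurable this
      filter_upwards [this] with x hx
      simpa [hs] using hx
    · have hm : Measurable fun q : ℝ≥0 × (V → ℝ≥0) => q.2 s := by fun_prop
      exact hm hN.compl
  have h2 := Measure.ae_ae_of_ae_compProd h1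
  have h3 : ∀ᶠ t : ℝ≥0 in atTop, 0 < t := eventually_gt_atTop 0
  filter_upwards [h2.filter_mono inf_le_right, h3.filter_mono inf_le_left] with t ht ht0
  have hm : MeasurableSet {x : V → ℝ≥0 | t * x s ∉ N} := by
    have hm' : Measurable fun x : V → ℝ≥0 => t * x s := by fun_prop
    exact hm' hN.compl
  have h4 : ∀ᵐ x ∂(scaledField P W u t : Measure (V → ℝ≥0)), t * x s ∉ N := by
    rw [toMeasure_scaledField, ae_map_iff (measurable_div_const_pi t).aemeasurable hm]
    filter_upwards [ht] with x hx
    rwa [mul_div_cancel₀ _ ht0.ne']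
  filter_upwards [h4] with x hx
  by_contra hcon
  exact hx (hpN hcon)

open Classical in
/-- Replaces the coordinates of `x` in `A` by those of `y`. -/
noncomputable def glue (A : Set V) (q : (V → ℝ≥0) × (A → ℝ≥0)) : V → ℝ≥0 :=
  fun v => if h : v ∈ A then q.2 ⟨v, h⟩ else q.1 v

omit [Finite V] in
theorem glue_of_mem {A : Set V} {v : V} (hv : v ∈ A) (q : (V → ℝ≥0) × (A → ℝ≥0)) :
    glue A q v = q.2 ⟨v, hv⟩ := by simp [glue, hv]

omit [Finite V] in
theorem glue_of_notMem {A : Set V} {v : V} (hv : v ∉ A) (q : (V → ℝ≥0) × (A → ℝ≥0)) :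
    glue A q v = q.1 v := by simp [glue, hv]

omit [Finite V] in
theorem continuous_glue (A : Set V) : Continuous (glue A) := by
  refine continuous_pi fun v => ?_
  by_cases hv : v ∈ A
  · simp only [glue_of_mem hv]; fun_prop
  · simp only [glue_of_notMem hv]; fun_prop

omit [Finite V] in
theorem measurable_glue (A : Set V) : Measurable (glue A) := by
  refine measurable_pi_lambda _ fun v => ?_
  by_cases hv : v ∈ A
  · simp only [glue_of_mem hv]; fun_prop
  · simp only [glue_of_notMem hv]; fun_prop

omit [Finite V] in
theorem glue_div (A : Set V) (x : V → ℝ≥0) (y : A → ℝ≥0) (t : ℝ≥0) :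
    (fun v => glue A (x, y) v / t) = glue A (fun v => x v / t, fun v => y v / t) := by
  funext v
  by_cases hv : v ∈ A
  · simp [glue_of_mem hv]
  · simp [glue_of_notMem hv]

omit [Finite V] in
theorem glue_indicator (W A : Set V) (x : V → ℝ≥0) :
    glue A (W.indicator x, A.domRestrict x) = (W ∪ A).indicator x := by
  funext v
  by_cases hv : v ∈ A
  · simp [glue_of_mem hv, hv]
  · by_cases hw : v ∈ W <;> simp [glue_of_notMem hv, hv, hw]

/-- The conditional law of the coordinates in `A` given `x_s`, as a kernel of `x`. -/
noncomputable def condLawAt (P : Measure (V → ℝ≥0)) [IsProbabilityMeasure P] (A : Set V) (s : V) :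
    Kernel (V → ℝ≥0) (A → ℝ≥0) :=
  (condLaw P A s).comap (fun x => x s) (measurable_pi_apply s)

instance (A : Set V) (s : V) : IsMarkovKernel (condLawAt P A s) := by
  unfold condLawAt; infer_instance

/-- The set `A` may be empty here, as happens when only `u` is covered and `s = u`; its σ-algebra is
then trivial. Conditioning is moved from the vector indexed by `{s}` to the coordinate `s`, which
generates the same σ-algebra. -/
theorem IsMarkovRandomField.condIndepFun (hM : IsMarkovRandomField G P) {A B : Set V} {s : V}
    (hB : B.Nonempty) (hAB : Disjoint A B) (hsA : s ∉ A) (hsB : s ∉ B)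
    (hsep : IsSeparator G {s} A B) :
    CondIndepFun (MeasurableSpace.comap (fun x : V → ℝ≥0 => x s) inferInstance)
      (measurable_pi_apply s).comap_le (A.domRestrict (π := fun _ => ℝ≥0))
      (B.domRestrict (π := fun _ => ℝ≥0)) P := by
  rcases A.eq_empty_or_nonempty with rfl | hA
  · have hbot : MeasurableSpace.comap ((∅ : Set V).domRestrict (π := fun _ => ℝ≥0)) inferInstance =
        ⊥ := by
      refine le_bot_iff.1 ?_
      rintro _ ⟨S, -, rfl⟩
      rcases S.eq_empty_or_nonempty with rfl | hS
      · exact MeasurableSpace.measurableSet_empty _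
      · rw [Subsingleton.eq_univ_of_nonempty hS]
        exact @MeasurableSet.univ _ ⊥
    rw [condIndepFun_iff_condIndep, hbot]
    exact condIndep_bot_left _
  · have key : ∀ m₁ m₂ : MeasurableSpace (V → ℝ≥0), m₁ = m₂ → ∀ (h₁ : m₁ ≤ MeasurableSpace.pi)
        (h₂ : m₂ ≤ MeasurableSpace.pi),
        CondIndepFun m₁ h₁ (A.domRestrict (π := fun _ => ℝ≥0))
          (B.domRestrict (π := fun _ => ℝ≥0)) P →
        CondIndepFun m₂ h₂ (A.domRestrict (π := fun _ => ℝ≥0))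
          (B.domRestrict (π := fun _ => ℝ≥0)) P := by
      rintro m₁ _ rfl h₁ h₂ h
      exact h
    refine key _ _ ?_ _ _ (hM A B {s} hA hB (Set.singleton_nonempty s) hAB
      (Set.disjoint_singleton_right.2 hsA) (Set.disjoint_singleton_right.2 hsB) hsep)
    apply le_antisymm
    · have hφ : Measurable fun (r : ℝ≥0) (_ : ({s} : Set V)) => r := by fun_prop
      have h : ({s} : Set V).domRestrict (π := fun _ => ℝ≥0) =
          (fun (r : ℝ≥0) (_ : ({s} : Set V)) => r) ∘ fun x => x s := by
        funext x v
        simp [Set.mem_singleton_iff.1 v.2]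
      rw [h, ← MeasurableSpace.comap_comp]
      exact MeasurableSpace.comap_mono hφ.comap_le
    · have hφ : Measurable fun q : ({s} : Set V) → ℝ≥0 => q ⟨s, rfl⟩ := by fun_prop
      have h : (fun x : V → ℝ≥0 => x s) = (fun q : ({s} : Set V) → ℝ≥0 => q ⟨s, rfl⟩) ∘
          ({s} : Set V).domRestrict (π := fun _ => ℝ≥0) := rfl
      rw [h, ← MeasurableSpace.comap_comp]
      exact MeasurableSpace.comap_mono hφ.comap_le

/-- Conditional independence in kernel form: given the whole field on `W`, the law on `B` depends on
`x_s` alone. -/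
theorem IsMarkovRandomField.map_prodMk (hM : IsMarkovRandomField G P) {W B : Set V} {s : V}
    (hB : B.Nonempty) (hWB : Disjoint W B) (hsW : s ∈ W)
    (hsep : IsSeparator G {s} (W \ {s}) B) :
    P.map (fun x => (W.indicator x, B.domRestrict (π := fun _ => ℝ≥0) x)) =
      P.map (fun x => W.indicator x) ⊗ₘ condLawAt P B s := by
  classical
  have hsB : s ∉ B := Set.disjoint_left.1 hWB hsW
  have h1 := hM.condIndepFun (A := W \ {s}) hB (hWB.mono_left Set.sdiff_subset) (fun h => h.2 rfl) hsB hsep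
  have hA := measurable_domRestrict (W \ {s})
  have hBm := measurable_domRestrict B
  have h2 := (condIndepFun_iff_condDistrib_prod_ae_eq_prodMkRight (μ := P) hBm hA
    (measurable_pi_apply s)).1 h1
  rw [condDistrib_ae_eq_iff_measure_eq_compProd _ hBm.aemeasurable] at h2
  -- Reassembles the field on `W` from `x_s` and the remaining coordinates.
  let φ : ℝ≥0 × (↥(W \ {s}) → ℝ≥0) → V → ℝ≥0 := fun q v =>
    if h : v ∈ W \ {s} then q.2 ⟨v, h⟩ else if v = s then q.1 else 0
  have hφ : Measurable φ := by
    refine measurable_pi_lambda _ fun v => ?_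
    by_cases h : v ∈ W \ {s}
    · simp only [φ, h, dite_true]; fun_prop
    · simp only [φ, h, dite_false]
      by_cases h' : v = s
      · simp only [h', if_true]; fun_prop
      · simp only [h', if_false]; fun_prop
  have hφW : ∀ x : V → ℝ≥0, φ (x s, (W \ {s}).domRestrict x) = W.indicator x := by
    intro x
    funext v
    by_cases h' : v = s
    · subst h'
      simp [φ, hsW]
    · by_cases h : v ∈ W <;> simp [φ, h, h']
  have hker : (condDistrib (B.domRestrict (π := fun _ => ℝ≥0)) (fun x => x s) P).prodMkRight
      (↥(W \ {s}) → ℝ≥0) = (condLawAt P B s).comap φ hφ := by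
    ext1 q
    have : φ q s = q.1 := by simp [φ]
    simp only [Kernel.prodMkRight_apply, Kernel.comap_apply, condLawAt, condLaw, this]
  rw [hker] at h2
  have h3 := congrArg (Measure.map (Prod.map φ id)) h2
  rw [map_compProd_comap, Measure.map_map (by fun_prop) (by fun_prop),
    Measure.map_map hφ (by fun_prop)] at h3
  simpa only [Function.comp_def, Prod.map_apply, hφW, id_eq] using h3

/-- The conditional law on `W ∪ B` is obtained by a transition from `x_s` to the nodes of `B`. -/
theorem fieldKernel_union {W B : Set V} {s u : V} (huW : u ∈ W)
    (h : P.map (fun x => (W.indicator x, B.domRestrict (π := fun _ => ℝ≥0) x)) =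
      P.map (fun x => W.indicator x) ⊗ₘ condLawAt P B s) :
    ∀ᵐ t ∂margin P u, fieldKernel P (W ∪ B) u t =
      (fieldKernel P W u t ⊗ₘ condLawAt P B s).map (glue B) := by
  have hWm := measurable_indicator_pi W
  have hBm := measurable_domRestrict B
  have hg : Measurable (Prod.map (id : ℝ≥0 → ℝ≥0) (glue B)) :=
    measurable_id.prodMap (measurable_glue B)
  have key : fieldKernel P (W ∪ B) u =ᵐ[P.map fun x => x u]
      ((fieldKernel P W u ⊗ₖ (condLawAt P B s).prodMkLeft ℝ≥0).map (glue B)) := by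
    have : IsMarkovKernel ((fieldKernel P W u ⊗ₖ (condLawAt P B s).prodMkLeft ℝ≥0).map (glue B)) :=
      Kernel.IsMarkovKernel.map _ (measurable_glue B)
    refine condDistrib_ae_eq_of_measure_eq_compProd_of_measurable (measurable_pi_apply u)
      (measurable_indicator_pi _) ?_
    rw [Measure.compProd_map (measurable_glue B), ← Measure.compProd_assoc']
    have h1 := margin_compProd_fieldKernel (P := P) W u
    rw [margin] at h1
    rw [h1]
    -- As `u ∈ W`, the conditioning variable is a function of the field on `W`, so the joint law is
    -- carried by a graph.
    have h2 : P.map (fun x => (x u, W.indicator x)) =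
        (P.map fun x => W.indicator x).map (fun w => (w u, w)) := by
      rw [Measure.map_map (by fun_prop) hWm]
      congr 1
      funext x
      simp [huW]
    have h3 : condLawAt P B s = ((condLawAt P B s).prodMkLeft ℝ≥0).comap
        (fun w : V → ℝ≥0 => (w u, w)) (by fun_prop) := by
      ext1 w; simp
    rw [h2, ← map_compProd_comap _ _ (by fun_prop), ← h3, ← h,
      Measure.map_map hg MeasurableEquiv.prodAssoc.measurable,
      Measure.map_map (hg.comp MeasurableEquiv.prodAssoc.measurable) (by fun_prop),
      Measure.map_map (by fun_prop) (by fun_prop)]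
    congr 1
    funext x
    simp only [Function.comp_apply, Prod.map_apply, id_eq, MeasurableEquiv.prodAssoc,
      MeasurableEquiv.coe_mk, Equiv.prodAssoc_apply]
    rw [glue_indicator]
    simp [huW]
  filter_upwards [key] with t ht
  rw [ht, Kernel.map_apply _ (measurable_glue B), Kernel.compProd_apply_eq_compProd_sectR]
  congr 2

end

/-! ### Adding one clique: the transition and its limit. -/

section

variable {V : Type u} [Finite V] {P : Measure (V → ℝ≥0)} [IsProbabilityMeasure P]

/-- The field `x`, continued to `B` by the multiples `x_s y` of `y`. -/
noncomputable def extend (B : Set V) (s : V) (q : (V → ℝ≥0) × (B → ℝ≥0)) : V → ℝ≥0 :=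
  glue B (q.1, fun v => q.1 s * q.2 v)

omit [Finite V] in
theorem continuous_extend (B : Set V) (s : V) : Continuous (extend B s) :=
  (continuous_glue B).comp (by fun_prop)

omit [Finite V] in
theorem measurable_extend (B : Set V) (s : V) : Measurable (extend B s) :=
  (measurable_glue B).comp (by fun_prop)

/-- The conditional expectation of `F` of the field continued to `B`, given that the field
divided by `t` is `x` on `W`. -/
noncomputable def transition (P : Measure (V → ℝ≥0)) [IsProbabilityMeasure P] (B : Set V) (s : V)
    (F : (V → ℝ≥0) →ᵇ ℝ) (t : ℝ≥0) (x : V → ℝ≥0) : ℝ :=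
  ∫ y, F (glue B (x, fun v => y v / t)) ∂condLaw P B s (t * x s)

variable {B : Set V} {s : V} (F : (V → ℝ≥0) →ᵇ ℝ)

theorem stronglyMeasurable_transition (t : ℝ≥0) :
    StronglyMeasurable (transition P B s F t) := by
  have hm : Measurable fun x : V → ℝ≥0 => t * x s := by fun_prop
  have h1 : Measurable fun q : (V → ℝ≥0) × (B → ℝ≥0) => (q.1, fun v => q.2 v / t) := by fun_prop
  have hF : StronglyMeasurable fun q : (V → ℝ≥0) × (B → ℝ≥0) =>
      F (glue B (q.1, fun v => q.2 v / t)) :=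
    (F.continuous.measurable.comp ((measurable_glue B).comp h1)).stronglyMeasurable
  exact hF.integral_kernel_prod_right' (κ := (condLaw P B s).comap _ hm)

theorem abs_transition_le (t : ℝ≥0) (x : V → ℝ≥0) : |transition P B s F t x| ≤ ‖F‖ := by
  rw [← Real.norm_eq_abs]
  refine (norm_integral_le_of_norm_le_const (ae_of_all _ fun y => F.norm_coe_le_norm _)).trans ?_
  simp

/-- The limit of `transition`. -/
noncomputable def limitTransition (s : V) (νB : ProbabilityMeasure (B → ℝ≥0))
    (F : (V → ℝ≥0) →ᵇ ℝ) : (V → ℝ≥0) →ᵇ ℝ :=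
  BoundedContinuousFunction.ofNormedAddCommGroup
    (fun x => ∫ y, F (extend B s (x, y)) ∂(νB : Measure (B → ℝ≥0)))
    ((continuous_integral_prod (F.compContinuous ⟨_, continuous_extend B s⟩)).comp
      (continuous_id.prodMk continuous_const)) ‖F‖ (fun x => by
        refine (norm_integral_le_of_norm_le_const
          (ae_of_all _ fun y => F.norm_coe_le_norm _)).trans ?_
        simp)

theorem limitTransition_apply (νB : ProbabilityMeasure (B → ℝ≥0)) (x : V → ℝ≥0) :
    limitTransition s νB F x = ∫ y, F (extend B s (x, y)) ∂(νB : Measure (B → ℝ≥0)) := rfl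

/-- Change of scale: `y / t = x_s * (y / (t * x_s))`, where `t * x_s` is the value conditioned on,
so that Assumption 1 can be applied. -/
theorem transition_eq {t : ℝ≥0} (ht : t ≠ 0) {x : V → ℝ≥0} (hx : x s ≠ 0) :
    transition P B s F t x =
      ∫ y, F (extend B s (x, y)) ∂(scaledCondLaw P B s (t * x s) : Measure (B → ℝ≥0)) := by
  have hm : Measurable fun (y : B → ℝ≥0) v => y v / (t * x s) := measurable_div_const_pi _
  have h1 : (scaledCondLaw P B s (t * x s) : Measure (B → ℝ≥0)) =
    (condLaw P B s (t * x s)).map (fun y v => y v / (t * x s)) := rfl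
  have hF : Measurable fun y : B → ℝ≥0 => F (extend B s (x, y)) :=
    F.continuous.measurable.comp ((measurable_extend B s).comp measurable_prodMk_left)
  rw [h1, integral_map hm.aemeasurable hF.aestronglyMeasurable]
  refine integral_congr_ae (ae_of_all _ fun y => ?_)
  simp only [extend]
  congr 3
  funext v
  field_simp

/-- Near fields with positive `s`-coordinate, `transition` is close to its limit. -/
theorem transition_close_of_pos {νB : ProbabilityMeasure (B → ℝ≥0)}
    (hν : CondTendsto P B s νB) {W : Set V} (hs : s ∈ W) (u : V) {x : V → ℝ≥0} (hx : 0 < x s)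
    {ε : ℝ} (hε : 0 < ε) :
    ∃ U ∈ 𝓝 x, ∀ᶠ t in atTop ⊓ ae (margin P u),
      ∀ᵐ y ∂(scaledField P W u t : Measure (V → ℝ≥0)), y ∈ U →
        |transition P B s F t y - limitTransition s νB F y| ≤ ε := by
  have hc := continuous_integral_prod (F.compContinuous ⟨_, continuous_extend B s⟩)
  have h1 := Metric.tendsto_nhds.1 (hc.tendsto (x, νB)) (ε / 2) (half_pos hε)
  rw [nhds_prod_eq] at h1
  obtain ⟨p, hp, q, hq, hpq⟩ := eventually_prod_iff.1 h1
  obtain ⟨R, hR⟩ := hν.exists_forall_ae hq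
  have hpos : ∀ᶠ y : V → ℝ≥0 in 𝓝 x, x s / 2 < y s :=
    (continuous_apply s).tendsto x |>.eventually (lt_mem_nhds (half_lt_self hx))
  refine ⟨_, hp.and hpos, ?_⟩
  -- Near `x` the coordinate `y s` exceeds `x s / 2`, so this makes the conditioning value `t * y s`
  -- at least `R`.
  have ht : ∀ᶠ t : ℝ≥0 in atTop ⊓ ae (margin P u), 0 < t ∧ R / (x s / 2) ≤ t :=
    ((eventually_gt_atTop 0).and (eventually_ge_atTop _)).filter_mono inf_le_left
  filter_upwards [ae_scaledField_of_ae_margin hs u hR, ht] with t h2 ht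
  filter_upwards [h2] with y hy hyU
  obtain ⟨hyp, hys⟩ := hyU
  have hys0 : y s ≠ 0 := ((half_pos hx).trans hys).ne'
  have hRt : R ≤ t * y s := by
    rw [div_le_iff₀ (half_pos hx)] at ht
    exact ht.2.trans (by gcongr)
  have h3 := hpq hyp (hy hRt)
  have h4 := hpq hyp (mem_of_mem_nhds hq)
  rw [transition_eq F ht.1.ne' hys0, limitTransition_apply]
  have h5 := dist_triangle_right _ _ _ |>.trans (add_le_add h3.le h4.le)
  rw [add_halves, Real.dist_eq] at h5
  exact h5

/-- Near fields that vanish at `s`, `transition` is close to its limit. -/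
theorem transition_close_of_eq_zero (νB : ProbabilityMeasure (B → ℝ≥0))
    (hsmall : SmallGivenSmall P B s) {W : Set V} (hs : s ∈ W) (u : V) {x : V → ℝ≥0}
    (hx : x s = 0) {ε : ℝ} (hε : 0 < ε) :
    ∃ U ∈ 𝓝 x, ∀ᶠ t in atTop ⊓ ae (margin P u),
      ∀ᵐ y ∂(scaledField P W u t : Measure (V → ℝ≥0)), y ∈ U →
        |transition P B s F t y - limitTransition s νB F y| ≤ ε := by
  have := Fintype.ofFinite B
  -- When `x s = 0`, the limiting continuation to `B` is zero whatever the increments, so both the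
  -- limit and `transition` are compared with this constant.
  set c : ℝ := F (glue B (x, 0)) with hc
  have hlim : limitTransition s νB F x = c := by
    rw [limitTransition_apply]
    have : ∀ y : B → ℝ≥0, extend B s (x, y) = glue B (x, 0) := by
      intro y
      rw [extend]
      congr 2
      funext v
      simp [hx]
    simp [this, hc]
  have h1 : ∀ᶠ y in 𝓝 x, dist (limitTransition s νB F y) c < ε / 3 := by
    rw [← hlim]
    exact Metric.tendsto_nhds.1 ((limitTransition s νB F).continuous.tendsto x) _ (by positivity)
  have h2 := Metric.tendsto_nhds.1
    ((F.continuous.comp (continuous_glue B)).tendsto (x, (0 : B → ℝ≥0))) (ε / 3) (by positivity)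
  rw [nhds_prod_eq] at h2
  obtain ⟨p, hp, q, hq, hpq⟩ := eventually_prod_iff.1 h2
  obtain ⟨r, hr, hrq⟩ := Metric.eventually_nhds_iff.1 hq
  let η : ℝ≥0 := ⟨r / 2, by positivity⟩
  have hη : 0 < η := by
    rw [← NNReal.coe_pos]; exact half_pos hr
  have hq' : ∀ y : B → ℝ≥0, (∀ v, y v ≤ η) → q y := by
    intro y hy
    refine hrq (lt_of_le_of_lt ((dist_pi_le_iff (half_pos hr).le).2 fun v => ?_) (half_lt_self hr))
    have : (y v : ℝ) ≤ r / 2 := by exact_mod_cast hy v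
    simpa [NNReal.dist_eq] using this
  -- Bounds the deviation of `F` from `c` on the rare event `E`; the `1` keeps it positive.
  set K : ℝ := 2 * ‖F‖ + 1
  have hK : 0 < K := by positivity
  obtain ⟨δ, hδ, T, hT⟩ := hsmall.exists_forall_ae hη
    (ε := ENNReal.ofReal (ε / (3 * K))) (by simpa using by positivity)
  have hsδ : ∀ᶠ y : V → ℝ≥0 in 𝓝 x, y s < δ :=
    (continuous_apply s).tendsto x |>.eventually (gt_mem_nhds (by simpa [hx] using hδ))
  refine ⟨_, (h1.and hp).and hsδ, ?_⟩
  have ht : ∀ᶠ t : ℝ≥0 in atTop ⊓ ae (margin P u), 0 < t ∧ T ≤ t :=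
    ((eventually_gt_atTop 0).and (eventually_ge_atTop _)).filter_mono inf_le_left
  filter_upwards [ae_scaledField_of_ae_margin hs u hT, ht] with t h3 ht
  filter_upwards [h3] with y hy hyU
  obtain ⟨⟨hy1, hyp⟩, hyδ⟩ := hyU
  have h4 := hy t ht.2 (by rw [mul_comm]; gcongr)
  set κ := condLaw P B s (t * y s)
  set E : Set (B → ℝ≥0) := {z | ∃ v, η < z v / t}
  have hE : MeasurableSet E := by
    have : E = ⋃ v, {z : B → ℝ≥0 | η < z v / t} := by ext z; simp [E]
    rw [this]
    refine MeasurableSet.iUnion fun v => ?_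
    have hm : Measurable fun z : B → ℝ≥0 => z v / t := by fun_prop
    exact hm measurableSet_Ioi
  have hEr : κ.real E ≤ ε / (3 * K) :=
    ENNReal.toReal_le_of_le_ofReal (by positivity) h4
  have hFm : AEStronglyMeasurable (fun z : B → ℝ≥0 => F (glue B (y, fun v => z v / t))) κ := by
    have hm : Measurable fun z : B → ℝ≥0 => (y, fun v => z v / t) := by fun_prop
    exact (F.continuous.measurable.comp ((measurable_glue B).comp hm)).aestronglyMeasurable
  have hFi : Integrable (fun z : B → ℝ≥0 => F (glue B (y, fun v => z v / t))) κ :=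
    Integrable.of_bound hFm ‖F‖ (ae_of_all _ fun z => F.norm_coe_le_norm _)
  have hbound : ∀ z : B → ℝ≥0, ‖F (glue B (y, fun v => z v / t)) - c‖ ≤
      ε / 3 + E.indicator (fun _ => K) z := by
    intro z
    by_cases hz : z ∈ E
    · rw [Set.indicator_of_mem hz]
      have e1 := F.norm_coe_le_norm (glue B (y, fun v => z v / t))
      have e2 : ‖c‖ ≤ ‖F‖ := F.norm_coe_le_norm _
      have e3 := norm_sub_le (F (glue B (y, fun v => z v / t))) c
      simp only [K]
      linarith
    · rw [Set.indicator_of_notMem hz, add_zero]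
      have := hpq hyp (hq' (fun v => z v / t) fun v => by
        by_contra hcon
        exact hz ⟨v, not_le.1 hcon⟩)
      rw [dist_eq_norm] at this
      exact this.le
  have hclose : |transition P B s F t y - c| ≤ ε / 3 + ε / 3 := by
    have e1 : transition P B s F t y - c =
        ∫ z, F (glue B (y, fun v => z v / t)) - c ∂κ := by
      rw [integral_sub hFi (integrable_const _)]
      simp [transition, κ]
    rw [e1, ← Real.norm_eq_abs]
    calc ‖∫ z, F (glue B (y, fun v => z v / t)) - c ∂κ‖
        ≤ ∫ z, ε / 3 + E.indicator (fun _ => K) z ∂κ :=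
          norm_integral_le_of_norm_le ((integrable_const _).add
            ((integrable_const _).indicator hE)) (ae_of_all _ hbound)
      _ = ε / 3 + κ.real E * K := by
          rw [integral_add (integrable_const _) ((integrable_const _).indicator hE),
            integral_indicator hE]
          simp
      _ ≤ ε / 3 + ε / (3 * K) * K := by gcongr
      _ = ε / 3 + ε / 3 := by field_simp
  rw [Real.dist_eq] at hy1
  have := abs_sub_le (transition P B s F t y) c (limitTransition s νB F y)
  rw [abs_sub_comm c] at this
  linarith

/-- Integrating `F` against the field on `W ∪ B` amounts to integrating `transition` against the
field on `W`. -/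
theorem integral_scaledField_union {W : Set V} {u : V} {t : ℝ≥0} (ht : t ≠ 0)
    (h : fieldKernel P (W ∪ B) u t = (fieldKernel P W u t ⊗ₘ condLawAt P B s).map (glue B)) :
    ∫ x, F x ∂(scaledField P (W ∪ B) u t : Measure (V → ℝ≥0)) =
      ∫ x, transition P B s F t x ∂(scaledField P W u t : Measure (V → ℝ≥0)) := by
  have hd : Measurable fun (x : V → ℝ≥0) v => x v / t := measurable_div_const_pi t
  have hF : StronglyMeasurable F := F.continuous.stronglyMeasurable
  have hg := measurable_glue B
  have hFd : StronglyMeasurable fun x : V → ℝ≥0 => F fun v => x v / t := hF.comp_measurable hd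
  rw [toMeasure_scaledField, toMeasure_scaledField, integral_map hd.aemeasurable
    hF.aestronglyMeasurable, integral_map hd.aemeasurable
    (stronglyMeasurable_transition F t).aestronglyMeasurable, h,
    integral_map hg.aemeasurable hFd.aestronglyMeasurable,
    Measure.integral_compProd]
  · refine integral_congr_ae (ae_of_all _ fun x => ?_)
    simp only [transition, glue_div, mul_div_cancel₀ _ ht]
    rfl
  · exact Integrable.of_bound (hF.comp_measurable (hd.comp hg)).aestronglyMeasurable ‖F‖
      (ae_of_all _ fun z => F.norm_coe_le_norm _)

/-- Weak convergence of the scaled field on `W` propagates to `W ∪ B`. -/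
theorem tendsto_scaledField_union {W : Set V} {u : V} (hs : s ∈ W)
    {νB : ProbabilityMeasure (B → ℝ≥0)} {ρ : ProbabilityMeasure (V → ℝ≥0)}
    (hdis : ∀ᵐ t ∂margin P u, fieldKernel P (W ∪ B) u t =
      (fieldKernel P W u t ⊗ₘ condLawAt P B s).map (glue B))
    (hν : CondTendsto P B s νB)
    (hW : Tendsto (scaledField P W u) (atTop ⊓ ae (margin P u)) (𝓝 ρ))
    (hzero : (ρ : Measure (V → ℝ≥0)) {x | x s = 0} ≠ 0 → SmallGivenSmall P B s) :
    Tendsto (scaledField P (W ∪ B) u) (atTop ⊓ ae (margin P u))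
      (𝓝 ((ρ.prod νB).map (measurable_extend B s).aemeasurable)) := by
  rw [ProbabilityMeasure.tendsto_iff_forall_integral_tendsto]
  intro F
  have hgen := tendsto_integral_of_locally_close hW (H := transition P B s F)
    (fun t => (stronglyMeasurable_transition F t).aestronglyMeasurable) (limitTransition s νB F)
    (abs_transition_le F) (fun ε hε => by
      have hae : ∀ᵐ x ∂(ρ : Measure (V → ℝ≥0)), x s = 0 → SmallGivenSmall P B s := by
        by_cases h0 : (ρ : Measure (V → ℝ≥0)) {x | x s = 0} = 0
        · have : ∀ᵐ x ∂(ρ : Measure (V → ℝ≥0)), ¬ x s = 0 := by rw [ae_iff]; simpa using h0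
          filter_upwards [this] with x hx h using absurd h hx
        · exact ae_of_all _ fun x _ => hzero h0
      filter_upwards [hae] with x hx
      by_cases hxs : x s = 0
      · exact transition_close_of_eq_zero F νB (hx hxs) hs u hxs hε
      · exact transition_close_of_pos F hν hs u (pos_iff_ne_zero.2 hxs) hε)
  have hlim : ∫ x, F x ∂(((ρ.prod νB).map (measurable_extend B s).aemeasurable :
      ProbabilityMeasure (V → ℝ≥0)) : Measure (V → ℝ≥0)) =
      ∫ x, limitTransition s νB F x ∂(ρ : Measure (V → ℝ≥0)) := by
    have hF : StronglyMeasurable F := F.continuous.stronglyMeasurable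
    rw [ProbabilityMeasure.toMeasure_map, integral_map (measurable_extend B s).aemeasurable
      hF.aestronglyMeasurable, ProbabilityMeasure.toMeasure_prod, integral_prod]
    · rfl
    · exact Integrable.of_bound (hF.comp_measurable (measurable_extend B s)).aestronglyMeasurable
        ‖F‖ (ae_of_all _ fun z => F.norm_coe_le_norm _)
  rw [hlim]
  refine hgen.congr' ?_
  have ht : ∀ᶠ t : ℝ≥0 in atTop, 0 < t := eventually_gt_atTop 0
  filter_upwards [ht.filter_mono inf_le_left, hdis.filter_mono inf_le_right] with t ht h
  exact (integral_scaledField_union F ht.ne' h).symm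

end

/-! ### Induction over the cliques and conclusion. -/

section

variable {V : Type u} [Finite V] {G : SimpleGraph V} {P : Measure (V → ℝ≥0)}
  [IsProbabilityMeasure P]

omit [Finite V] in
theorem coveredNodes_empty (u : V) : coveredNodes G u ∅ = {u} := by
  ext v; simp [coveredNodes]

omit [Finite V] in
theorem coveredNodes_insert (u : V) (C : MaxClique G) (𝒟 : Set (MaxClique G)) :
    coveredNodes G u (insert C 𝒟) = coveredNodes G u 𝒟 ∪ C.1 \ {sepNode G u C.1} := by
  ext v
  constructor
  · rintro (h | ⟨D, rfl | hD, h⟩)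
    exacts [Or.inl (Or.inl h), Or.inr h, Or.inl (Or.inr ⟨D, hD, h⟩)]
  · rintro ((h | ⟨D, hD, h⟩) | h)
    exacts [Or.inl h, Or.inr ⟨D, Or.inr hD, h⟩, Or.inr ⟨C, Or.inl rfl, h⟩]

omit [Finite V] in
theorem mem_coveredNodes_self (u : V) (𝒟 : Set (MaxClique G)) : u ∈ coveredNodes G u 𝒟 :=
  Or.inl rfl

variable (hG : G.Connected)

/-- The products along shortest paths, put to zero outside `W`. -/
noncomputable def limitField (W : Set V) (u : V) (z : IncrementSpace G u) : V → ℝ≥0 :=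
  W.indicator fun v => pathProduct hG u v z

theorem measurable_limitField (W : Set V) (u : V) : Measurable (limitField hG W u) :=
  (measurable_indicator_pi W).comp (measurable_pi_lambda _ fun v => measurable_pathProduct hG u v)

/-- The law of the products along shortest paths, put to zero outside `W`. -/
noncomputable def limitFieldLaw
    (ν : (C : MaxClique G) → (s : V) → ProbabilityMeasure (↥(C.1 \ {s}) → ℝ≥0)) (W : Set V)
    (u : V) : ProbabilityMeasure (V → ℝ≥0) :=
  (incrementLaw ν u).map (measurable_limitField hG W u).aemeasurable

variable {hG} (hblock : IsBlockGraph G)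
  (ν : (C : MaxClique G) → (s : V) → ProbabilityMeasure (↥(C.1 \ {s}) → ℝ≥0))

include hblock in
theorem limitField_insert {u : V} {C : MaxClique G} {W : Set V} (hs : sepNode G u C.1 ∈ W)
    (z : IncrementSpace G u) :
    limitField hG (W ∪ C.1 \ {sepNode G u C.1}) u z =
      extend (C.1 \ {sepNode G u C.1}) (sepNode G u C.1) (limitField hG W u z, z C) := by
  funext v
  rw [extend]
  by_cases hv : v ∈ C.1 \ {sepNode G u C.1}
  · rw [glue_of_mem hv, limitField, Set.indicator_of_mem (Set.mem_union_right _ hv),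
      pathProduct_eq_mul hG hblock hv]
    simp only [limitField, Set.indicator_of_mem hs]
  · rw [glue_of_notMem hv]
    simp only [limitField]
    by_cases hw : v ∈ W
    · rw [Set.indicator_of_mem (Set.mem_union_left _ hw), Set.indicator_of_mem hw]
    · rw [Set.indicator_of_notMem (fun h => h.elim hw hv), Set.indicator_of_notMem hw]

-- The products on the covered nodes do not involve the sub-vector of `C`, so they are independent
-- of it; this identifies the limit found by adding `C`.
include hblock in
theorem limitFieldLaw_insert {u : V} {𝒟 : Set (MaxClique G)} {C : MaxClique G} (hC : C ∉ 𝒟)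
    (hle : ∀ D ∈ 𝒟, G.dist u (sepNode G u D.1) ≤ G.dist u (sepNode G u C.1))
    (hs : sepNode G u C.1 ∈ coveredNodes G u 𝒟) :
    ((limitFieldLaw hG ν (coveredNodes G u 𝒟) u).prod (ν C (sepNode G u C.1))).map
      (measurable_extend (C.1 \ {sepNode G u C.1}) (sepNode G u C.1)).aemeasurable =
      limitFieldLaw hG ν (coveredNodes G u (insert C 𝒟)) u := by
  have hm := measurable_limitField hG (coveredNodes G u 𝒟) u
  have h := map_prodMk_eval_pi (μ := fun D : MaxClique G =>
    (ν D (sepNode G u D.1) : Measure (↥(D.1 \ {sepNode G u D.1}) → ℝ≥0))) hm C (by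
      intro z z' hz
      simp only [limitField]
      refine Set.indicator_congr fun v hv => ?_
      exact pathProduct_congr hG hblock hC hle hv hz)
  apply Subtype.ext
  change Measure.map _ ((Measure.map _ _).prod _) = Measure.map _ _
  erw [← h]
  rw [Measure.map_map (measurable_extend _ _) (hm.prodMk (measurable_pi_apply C)),
    coveredNodes_insert]
  change Measure.map _ (Measure.pi _) = Measure.map _ (Measure.pi _)
  congr 1
  funext z
  exact (limitField_insert hblock hs z).symm

/-- Given `X_u = t`, the coordinate `u` is `t` for almost every `t`, so for `t > 0` the scaled field
on `{u}` is the constant `1`, the empty product. -/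
theorem tendsto_scaledField_empty (u : V) :
    Tendsto (scaledField P (coveredNodes G u ∅) u) (atTop ⊓ ae (margin P u))
      (𝓝 (limitFieldLaw hG ν (coveredNodes G u ∅) u)) := by
  rw [coveredNodes_empty]
  refine tendsto_const_nhds.congr' ?_
  let f : ℝ≥0 → V → ℝ≥0 := fun r => Set.indicator {u} fun _ => r
  have hf : Measurable f := (measurable_indicator_pi {u}).comp (by fun_prop)
  have hfu : (fun x : V → ℝ≥0 => Set.indicator {u} x) = f ∘ fun x => x u := by
    funext x v
    by_cases hv : v = u
    · subst hv; simp [f]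
    · simp [f, hv]
  have h1 : fieldKernel P {u} u =ᵐ[margin P u] Kernel.deterministic f hf := by
    rw [fieldKernel, hfu]
    exact condDistrib_comp_self _ hf
  have ht : ∀ᶠ t : ℝ≥0 in atTop, 0 < t := eventually_gt_atTop 0
  filter_upwards [ht.filter_mono inf_le_left, h1.filter_mono inf_le_right] with t ht h
  apply Subtype.ext
  change _ = (scaledField P {u} u t : Measure (V → ℝ≥0))
  rw [toMeasure_scaledField, h, Kernel.deterministic_apply,
    Measure.map_dirac' (measurable_div_const_pi t)]
  have h2 : limitField hG {u} u = fun _ => f 1 := by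
    funext z v
    by_cases hv : v = u
    · subst hv; simp [f, limitField, pathProduct_self]
    · simp [f, limitField, hv]
  have h3 : (fun v => f t v / t) = f 1 := by
    funext v
    by_cases hv : v = u
    · subst hv; simp [f, ht.ne']
    · simp [f, hv]
  change Measure.map (limitField hG {u} u) _ = _
  rw [h2, Measure.map_const, h3]
  simp

variable {ν}

include hblock in
theorem smallGivenSmall_of_limitFieldLaw (hzero : ZeroAssumption hG P ν) {u : V} {W : Set V}
    {C : MaxClique G} (hs : sepNode G u C.1 ∈ W)
    (h0 : (limitFieldLaw hG ν W u : Measure (V → ℝ≥0)) {x | x (sepNode G u C.1) = 0} ≠ 0) :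
    SmallGivenSmall P (C.1 \ {sepNode G u C.1}) (sepNode G u C.1) := by
  have hm : MeasurableSet {x : V → ℝ≥0 | x (sepNode G u C.1) = 0} :=
    measurable_pi_apply _ (measurableSet_singleton 0)
  have h1 : (incrementLaw ν u : Measure (IncrementSpace G u))
      {z | pathProduct hG u (sepNode G u C.1) z = 0} ≠ 0 := by
    rw [limitFieldLaw, ProbabilityMeasure.toMeasure_map,
      Measure.map_apply (measurable_limitField hG W u) hm] at h0
    simpa [limitField, hs] using h0
  -- Since `A_{uu} = 1`, the separator node is not `u`. It is thus reached through another clique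
  -- `D`, and lying in both it belongs to `separatorNodes G`.
  have hus : u ≠ sepNode G u C.1 := by
    intro h
    rw [← h] at h1
    simp [pathProduct_self] at h1
  obtain ⟨D, hD⟩ := exists_mem_diff_sepNode hG hblock hus
  have hDC : D ≠ C := by
    rintro rfl
    exact hD.2 rfl
  exact hzero u _ (mem_separatorNodes hblock hDC hD.1 (sepNode_mem hG hblock u C)) C
    (sepNode_mem hG hblock u C)
    (fun w hw hwC => eq_sepNode_of_mem_support_shortestPath hG hblock hw hwC)
    (exists_dart_of_pathProduct_eq_zero hG hblock ν h1)

include hblock in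
/-- One clique is added to the covered nodes. -/
theorem tendsto_scaledField_insert (hM : IsMarkovRandomField G P)
    (hν : CliquewiseLimits P ν) (hzero : ZeroAssumption hG P ν) {u : V} {𝒟 : Set (MaxClique G)}
    {C : MaxClique G} (hC : C ∉ 𝒟)
    (hle : ∀ D ∈ 𝒟, G.dist u (sepNode G u D.1) ≤ G.dist u (sepNode G u C.1))
    (hs : sepNode G u C.1 ∈ coveredNodes G u 𝒟)
    (h : Tendsto (scaledField P (coveredNodes G u 𝒟) u) (atTop ⊓ ae (margin P u))
      (𝓝 (limitFieldLaw hG ν (coveredNodes G u 𝒟) u))) :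
    Tendsto (scaledField P (coveredNodes G u (insert C 𝒟)) u) (atTop ⊓ ae (margin P u))
      (𝓝 (limitFieldLaw hG ν (coveredNodes G u (insert C 𝒟)) u)) := by
  -- A one-node clique adds nothing, and the Markov property needs `B` nonempty.
  rcases (C.1 \ {sepNode G u C.1}).eq_empty_or_nonempty with hB | hB
  · rwa [coveredNodes_insert, hB, Set.union_empty]
  · have hdisj : Disjoint (coveredNodes G u 𝒟) (C.1 \ {sepNode G u C.1}) := by
      rw [Set.disjoint_left]
      rintro v (rfl | ⟨D, hD, hvD⟩) hv
      · exact ne_of_mem_diff_sepNode hG hblock hv rfl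
      · exact hC (maxClique_eq_of_mem_diff hG hblock hvD hv ▸ hD)
    have hsep : IsSeparator G {sepNode G u C.1} (coveredNodes G u 𝒟 \ {sepNode G u C.1})
        (C.1 \ {sepNode G u C.1}) := by
      intro a ha b hb p _
      by_contra hcon
      simp only [Set.mem_singleton_iff, exists_eq_right] at hcon
      exact reachableAvoiding_sepNode_false hG hblock hC hle ha.1 hb ⟨p, hcon⟩
    have hdis := fieldKernel_union (mem_coveredNodes_self u 𝒟) (hM.map_prodMk hB hdisj hs hsep)
    rw [← limitFieldLaw_insert hblock ν hC hle hs, coveredNodes_insert]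
    exact tendsto_scaledField_union hs hdis (hν C _ (sepNode_mem hG hblock u C)) h
      (smallGivenSmall_of_limitFieldLaw hblock hzero hs)

-- The condition `hlow` survives the removal of a clique whose separator node is farthest from `u`.
-- It also ensures that this separator node stays covered: it is `u`, or it lies beyond the strictly
-- closer separator node of another clique.
include hblock in
theorem tendsto_scaledField (hM : IsMarkovRandomField G P)
    (hν : CliquewiseLimits P ν) (hzero : ZeroAssumption hG P ν) {u : V} (𝒟 : Finset (MaxClique G))
    (hlow : ∀ D ∈ 𝒟, ∀ D', G.dist u (sepNode G u D'.1) < G.dist u (sepNode G u D.1) → D' ∈ 𝒟) :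
    Tendsto (scaledField P (coveredNodes G u 𝒟) u) (atTop ⊓ ae (margin P u))
      (𝓝 (limitFieldLaw hG ν (coveredNodes G u 𝒟) u)) := by
  classical
  induction hn : 𝒟.card generalizing 𝒟 with
  | zero =>
    rw [Finset.card_eq_zero] at hn
    subst hn
    simpa using tendsto_scaledField_empty (hG := hG) ν u
  | succ n ih =>
    have hne : 𝒟.Nonempty := Finset.card_pos.1 (by omega)
    obtain ⟨C, hC, hmax⟩ := 𝒟.exists_max_image (fun D => G.dist u (sepNode G u D.1)) hne
    have h1 := ih (𝒟.erase C) (fun D hD D' hlt => by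
      have hD' := Finset.mem_of_mem_erase hD
      refine Finset.mem_erase.2 ⟨?_, hlow D hD' D' hlt⟩
      rintro rfl
      exact absurd (hmax D hD') (not_le.2 hlt)) (by rw [Finset.card_erase_of_mem hC]; omega)
    have hs : sepNode G u C.1 ∈ coveredNodes G u ↑(𝒟.erase C) := by
      by_cases hus : u = sepNode G u C.1
      · exact Or.inl hus.symm
      · obtain ⟨D, hD⟩ := exists_mem_diff_sepNode hG hblock hus
        have hlt := dist_eq_dist_sepNode_add_one hG hblock hD
        refine Or.inr ⟨D, ?_, hD⟩
        rw [Finset.mem_coe, Finset.mem_erase]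
        refine ⟨?_, hlow C hC D (by omega)⟩
        rintro rfl
        exact hD.2 rfl
    have h2 := tendsto_scaledField_insert hblock hM hν hzero (by simp)
      (fun D hD => hmax D (Finset.mem_of_mem_erase hD)) hs h1
    rwa [← Finset.coe_insert, Finset.insert_erase hC] at h2

include hblock in
theorem condTendsto_limitLaw (hM : IsMarkovRandomField G P) (hν : CliquewiseLimits P ν)
    (hzero : ZeroAssumption hG P ν) (u : V) : CondTendsto P {u}ᶜ u (limitLaw hG ν u) := by
  have h1 := tendsto_scaledField hblock hM hν hzero (u := u) Finset.univ fun _ _ _ _ =>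
    Finset.mem_univ _
  have huniv : coveredNodes G u ↑(Finset.univ : Finset (MaxClique G)) = Set.univ := by
    refine Set.eq_univ_of_forall fun v => ?_
    by_cases huv : u = v
    · exact Or.inl huv.symm
    · obtain ⟨D, hD⟩ := exists_mem_diff_sepNode hG hblock huv
      exact Or.inr ⟨D, by simp, hD⟩
  rw [huniv] at h1
  have hrc : Continuous (({u}ᶜ : Set V).domRestrict (π := fun _ => ℝ≥0)) :=
    continuous_pi fun v => continuous_apply v.1
  have hrm := measurable_domRestrict ({u}ᶜ : Set V)
  have h2 := ProbabilityMeasure.tendsto_map_of_tendsto_of_continuous _ _ h1 hrc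
  have hlim : (limitFieldLaw hG ν Set.univ u).map hrm.aemeasurable = limitLaw hG ν u := by
    apply Subtype.ext
    change Measure.map _ (Measure.map _ _) = Measure.map _ _
    rw [Measure.map_map hrm (measurable_limitField hG _ u)]
    congr 1
    funext z v
    simp [limitField]
  rw [hlim] at h2
  refine h2.congr' ?_
  -- The two sides are versions of the same conditional law and agree only almost everywhere, which
  -- suffices along a filter below `ae (margin P u)`.
  have h3 : condLaw P {u}ᶜ u =ᵐ[margin P u] (fieldKernel P Set.univ u).map
      (({u}ᶜ : Set V).domRestrict (π := fun _ => ℝ≥0)) := by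
    have h4 := condDistrib_comp (mβ := inferInstance) (μ := P) (fun x : V → ℝ≥0 => x u)
      (measurable_indicator_pi Set.univ).aemeasurable hrm
    have h5 : ({u}ᶜ : Set V).domRestrict (π := fun _ => ℝ≥0) ∘
        (fun x : V → ℝ≥0 => Set.univ.indicator x) =
          ({u}ᶜ : Set V).domRestrict (π := fun _ => ℝ≥0) := by
      funext x; simp
    rw [h5] at h4
    exact h4
  filter_upwards [h3.filter_mono inf_le_right] with t ht
  apply Subtype.ext
  change Measure.map _ (scaledField P Set.univ u t : Measure (V → ℝ≥0)) =
    Measure.map _ (condLaw P {u}ᶜ u t)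
  rw [ht, toMeasure_scaledField, Measure.map_map hrm (measurable_div_const_pi t),
    Kernel.map_apply _ hrm, Measure.map_map (measurable_div_const_pi t) hrm]
  rfl

end

end MarkovBlockGraph

theorem mainTheorem1 {V : Type*} [Finite V] (G : SimpleGraph V)
    (hG : G.Connected) (hblock : MarkovBlockGraph.IsBlockGraph G)
    {Ω : Type*} [MeasurableSpace Ω] (μ : Measure Ω) [IsProbabilityMeasure μ]
    (X : Ω → V → ℝ≥0) (hX : AEMeasurable X μ)
    (hMarkov : MarkovBlockGraph.IsMarkovRandomField G (μ.map X))
    (ν : (C : MarkovBlockGraph.MaxClique G) → (s : V) →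
      ProbabilityMeasure (↥(C.1 \ {s}) → ℝ≥0))
    (hν : MarkovBlockGraph.CliquewiseLimits (μ.map X) ν)
    (hzero : MarkovBlockGraph.ZeroAssumption hG (μ.map X) ν)
    (u : V) :
    MarkovBlockGraph.CondTendsto (μ.map X) ({u}ᶜ) u
      (MarkovBlockGraph.limitLaw hG ν u) := by
  have := Measure.isProbabilityMeasure_map hX
  exact MarkovBlockGraph.condTendsto_limitLaw hblock hMarkov hν hzero u
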